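/- Let $m\ge 0$ and let $S\subseteq\mathbb N^m$ be a finitely generated submonoid (an affine semigroup) with minimal generating set $A$. A presentation of $S$ is a set of pairs generating the kernel congruence of $\varphi:\mathbb N^{A}\to S$, $\mathbf e_{\mathbf a}\mapsto\mathbf a$; it is minimal if no proper subset is a presentation (all minimal presentations have the same cardinality). Assume that $S$ is a complete intersection, that is, the cardinality of its minimal presentations equals $|A|-\dim_{\mathbb Q}(\mathbb Q S)$. For a finite set $B\subseteq\mathbb N^m$ let $\langle B\rangle$ be the monoid generated by $B$ and $\mathrm G(\langle B\rangle)=\{\mathbf a-\mathbf b\mid \mathbf a,\mathbf b\in\langle B\rangle\}\subseteq\mathbb Z^m$. If $B=B_1\sqcup B_2$ with $B_1,B_2\neq\emptyset$, then $\langle B\rangle$ is the gluing $\langle B_1\rangle+_{\mathbf d}\langle B_2\rangle$ of $\langle B_1\rangle$ and $\langle B_2\rangle$ by $\mathbf d\neq 0$ if $\mathbf d\in\langle B_1\rangle\cap\langle B_2\rangle$ and $\mathrm G(\langle B_1\rangle)\cap\mathrm G(\langle B_2\rangle)=\mathbf d\mathbb Z$. Then there are a partition $A=A_1\sqcup\cdots\sqcup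 A_t$ into sets of linearly independent vectors, and $\mathbf d_1,\dots,\mathbf d_{t-1}\in\mathbb N^m\setminus\{0\}$, such that, for some way of inserting parentheses, \[S=\langle A_1\rangle+_{\mathbf d_1}\langle A_2\rangle+_{\mathbf d_2}\cdots+_{\mathbf d_{t-1}}\langle A_t\rangle .\] Moreover, for every such decomposition, the Hilbert series $\mathrm H(S,\mathbf x)=\sum_{\mathbf s\in S}\mathbf x^{\mathbf s}$ satisfies, as a formal power series in $x_1,\dots,x_m$, \[\mathrm H(S,\mathbf x)=\frac{\prod_{i=1}^{t-1}(1-\mathbf x^{\mathbf d_i})}{\prod_{\mathbf a\in A}(1-\mathbf x^{\mathbf a})}.\] -/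

import Mathlib

namespace AffineSemigroup

noncomputable section

/-- `A` is a minimal system of generators of the monoid `S ⊆ ℕ^m`: it generates `S` and none of
its proper subsets does. -/
def IsMinimalGenerating {m : ℕ} (S : AddSubmonoid (Fin m →₀ ℕ)) (A : Finset (Fin m →₀ ℕ)) : Prop :=
  Minimal (fun B : Finset (Fin m →₀ ℕ) =>
    AddSubmonoid.closure (B : Set (Fin m →₀ ℕ)) = S) A

/-- A vector of `ℕ^m` seen in `ℤ^m`. -/
def toInt {m : ℕ} (a : Fin m →₀ ℕ) : Fin m → ℤ := fun i => (a i : ℤ)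

/-- A vector of `ℕ^m` seen in `ℚ^m`. -/
def toRat {m : ℕ} (a : Fin m →₀ ℕ) : Fin m → ℚ := fun i => (a i : ℚ)

/-- The group `G(S) = {a - b | a, b ∈ S} ⊆ ℤ^m` spanned by `S`. -/
def groupSpan {m : ℕ} (S : AddSubmonoid (Fin m →₀ ℕ)) : Set (Fin m → ℤ) :=
  {z | ∃ a ∈ S, ∃ b ∈ S, z = toInt a - toInt b}

/-- The monoid homomorphism `φ : ℕ^A → ℕ^m`, `e_a ↦ a`; its image is the monoid `⟨A⟩`. -/
def factorizationHom {m : ℕ} (A : Finset (Fin m →₀ ℕ)) : (A →₀ ℕ) →+ (Fin m →₀ ℕ) :=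
  (Finsupp.linearCombination ℕ (fun a : A => (a : Fin m →₀ ℕ))).toAddMonoidHom

/-- `ρ` is a presentation of `⟨A⟩` (with respect to `A`): it generates the kernel congruence
of `φ`. -/
def IsPresentation {m : ℕ} (A : Finset (Fin m →₀ ℕ)) (ρ : Set ((A →₀ ℕ) × (A →₀ ℕ))) : Prop :=
  addConGen (fun x y => (x, y) ∈ ρ) = AddCon.ker (factorizationHom A)

/-- A minimal presentation: a presentation none of whose proper subsets is a presentation. -/
def IsMinimalPresentation {m : ℕ} (A : Finset (Fin m →₀ ℕ))
    (ρ : Set ((A →₀ ℕ) × (A →₀ ℕ))) : Prop :=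
  Minimal (IsPresentation A) ρ

/-- The dimension of the `ℚ`-vector space spanned by `S`. -/
def dimension {m : ℕ} (S : AddSubmonoid (Fin m →₀ ℕ)) : ℕ :=
  Module.finrank ℚ (Submodule.span ℚ (toRat '' (S : Set (Fin m →₀ ℕ))))

/-- `S` is a complete intersection affine semigroup: it is finitely generated, and the cardinality
of a minimal presentation is the embedding dimension minus the dimension. All minimal presentations
have the same cardinality, so it does not matter which one is taken; the minimal generating set of
`S` is unique. -/
def IsCompleteIntersection {m : ℕ} (S : AddSubmonoid (Fin m →₀ ℕ)) : Prop :=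
  ∃ A : Finset (Fin m →₀ ℕ), IsMinimalGenerating S A ∧
    ∃ ρ : Set ((A →₀ ℕ) × (A →₀ ℕ)), IsMinimalPresentation A ρ ∧
      ρ.encard + (dimension S : ℕ∞) = (A.card : ℕ∞)

/-- `A = A₁ ∪ A₂` is a nontrivial partition and `⟨A⟩` is the gluing `⟨A₁⟩ +_d ⟨A₂⟩` of `⟨A₁⟩` and
`⟨A₂⟩` by the nonzero vector `d`. -/
structure IsGluing {m : ℕ} (A A₁ A₂ : Finset (Fin m →₀ ℕ)) (d : Fin m →₀ ℕ) : Prop where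
  nonempty_left : A₁.Nonempty
  nonempty_right : A₂.Nonempty
  disjoint : Disjoint A₁ A₂
  union : A₁ ∪ A₂ = A
  ne_zero : d ≠ 0
  mem_left : d ∈ AddSubmonoid.closure (A₁ : Set (Fin m →₀ ℕ))
  mem_right : d ∈ AddSubmonoid.closure (A₂ : Set (Fin m →₀ ℕ))
  inter : groupSpan (AddSubmonoid.closure (A₁ : Set (Fin m →₀ ℕ))) ∩
      groupSpan (AddSubmonoid.closure (A₂ : Set (Fin m →₀ ℕ))) = {z | ∃ k : ℤ, z = k • toInt d}

/-- `IsIteratedGluing A [A₁, …, A_t] [d₁, …, d_{t-1}]`: for some way of inserting parentheses,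
`⟨A⟩ = ⟨A₁⟩ +_{d₁} ⟨A₂⟩ +_{d₂} ⋯ +_{d_{t-1}} ⟨A_t⟩`, where `A₁, …, A_t` is a partition of `A` and
every `A_i` is a set of linearly independent vectors. -/
inductive IsIteratedGluing {m : ℕ} :
    Finset (Fin m →₀ ℕ) → List (Finset (Fin m →₀ ℕ)) → List (Fin m →₀ ℕ) → Prop
  | free (A : Finset (Fin m →₀ ℕ))
      (h : LinearIndependent ℚ (fun a : A => toRat (a : Fin m →₀ ℕ))) :
      IsIteratedGluing A [A] []
  | glue (A A₁ A₂ : Finset (Fin m →₀ ℕ)) (d : Fin m →₀ ℕ)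
      (P₁ P₂ : List (Finset (Fin m →₀ ℕ))) (D₁ D₂ : List (Fin m →₀ ℕ))
      (h : IsGluing A A₁ A₂ d)
      (h₁ : IsIteratedGluing A₁ P₁ D₁) (h₂ : IsIteratedGluing A₂ P₂ D₂) :
      IsIteratedGluing A (P₁ ++ P₂) (D₁ ++ d :: D₂)

open Classical in
/-- The Hilbert series `H(S, x) = ∑_{s ∈ S} x^s`, a formal power series in `x₁, …, x_m`. -/
def hilbertSeries {m : ℕ} (S : AddSubmonoid (Fin m →₀ ℕ)) : MvPowerSeries (Fin m) ℚ :=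
  fun s => if s ∈ S then 1 else 0

/-- The polynomial `1 - x^a`, as a formal power series. -/
def oneSubPow {m : ℕ} (a : Fin m →₀ ℕ) : MvPowerSeries (Fin m) ℚ :=
  1 - MvPowerSeries.monomial a 1

end

end AffineSemigroup

/-!
The theorem of Fischer, Morris and Shapiro on complete intersection affine semigroups.

*Existence of a decomposition.* Let `n = |A|`, let `W` be the space of rational relations between
the vectors of `A`, and let `ρ` be a minimal presentation with `|ρ| = dim W` elements `(x, y)`. The
toric ideal `I` of `A` in `ℚ[X_a : a ∈ A]` is generated by the binomials `X^x - X^y` with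
`(x, y) ∈ ρ` (`IsPresentation.toricIdeal_eq_span`), it is prime, and its height is at least `dim W`
because a flag of subspaces of `W` gives a chain of toric primes
(`finrank_le_height_toricIdeal`). Call `(x, y)` mixed on `J ⊆ A` if both supports meet `J`. The
binomials mixed on `J` lie in the ideal of the variables `X_j`, `j ∈ J`, so Krull's height theorem,
applied to a minimal prime of `I + (X_j : j ∈ J)`, which contains `I` strictly, shows that fewer
than `|J|` elements of `ρ` are mixed on `J`, for every nonempty `J`
(`dominating_of_span_binomials`): the pairs of supports form a dominating family.

What remains is combinatorial. A nonempty dominating family has a cut: some row and a set `X` of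
columns, such that one side of the row lies in `X`, the other one in the complement, and each
other row lies in `X` or in the complement (`Dominating.exists_isCut`). This is proved by induction
from a more flexible statement (`Dominating.splitOrCut`) on two sets `U`, `W` of columns that may
be added to the family as a further row. The cut row expresses `⟨A⟩` as the gluing of
`⟨A ∩ X⟩` and `⟨A \ X⟩` by the common value of its two sides (`IsDominatingSystem.isGluing`), since
the rows generate the lattice of integer relations; the other rows do the same for `A ∩ X` and
`A \ X`, and one goes on until no row is left, when the vectors are linearly independent.

*Hilbert series.* For `d ∈ S`, the product `(1 - x^d) H(S, x)` is the series of the Apéry set of `S`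
with respect to `d`. In a gluing, every element is in a unique way the sum of an element of `⟨A₁⟩`
and an element of the Apéry set of `⟨A₂⟩` with respect to `d`, whence
`H(⟨A⟩) = (1 - x^d) H(⟨A₁⟩) H(⟨A₂⟩)` (`IsGluing.hilbertSeries_eq`). For linearly independent vectors
the same idea, one vector at a time, gives the inverse of `∏ (1 - x^a)`.
-/

namespace AffineSemigroup

/-! ### Sign patterns: dominating families of rows and cuts -/

/-- Row `i` is the pair of column sets `P i`, `N i` (the places of its positive and of its negative
entries). These are the rows of `R` which have entries of both signs in the columns `J`. -/
def mixedRows {ι V : Type*} [DecidableEq V] (P N : ι → Finset V) (R : Finset ι) (J : Finset V) :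
    Finset ι :=
  R.filter fun i => ¬ Disjoint (P i) J ∧ ¬ Disjoint (N i) J

/-- The rows `R` form a *dominating* matrix: no square submatrix has entries of both signs in each
of its rows. -/
def Dominating {ι V : Type*} [DecidableEq V] (P N : ι → Finset V) (R : Finset ι) : Prop :=
  ∀ J : Finset V, J.Nonempty → (mixedRows P N R J).card < J.card

/-- For a dominating `R`, this says that `R` stays dominating when a further row, with positive
places `U` and negative places `W`, is added. -/
def Separated {ι V : Type*} [DecidableEq V] (P N : ι → Finset V) (R : Finset ι)
    (U W : Finset V) : Prop :=
  ∀ J : Finset V, ¬ Disjoint U J → ¬ Disjoint W J → (mixedRows P N R J).card + 1 < J.card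

/-- All places of row `i` lie in `X`. -/
def RowInside {ι V : Type*} (P N : ι → Finset V) (i : ι) (X : Set V) : Prop :=
  (∀ v ∈ P i, v ∈ X) ∧ ∀ v ∈ N i, v ∈ X

/-- Row `i` is a cut of `R` along `X`: one of its sides, `Q`, lies in `X`, the other one, `Q'`,
in the complement, and all other rows lie in `X` or in the complement. -/
structure IsCut {ι V : Type*} (P N : ι → Finset V) (R : Finset ι) (i : ι) (X : Set V)
    (Q Q' : Finset V) : Prop where
  mem : i ∈ R
  subset : ∀ v ∈ Q, v ∈ X
  subset_compl : ∀ v ∈ Q', v ∉ X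
  sides : (Q = P i ∧ Q' = N i) ∨ (Q = N i ∧ Q' = P i)
  rows : ∀ j ∈ R, j ≠ i → RowInside P N j X ∨ RowInside P N j Xᶜ

/-- Either no row of `R` crosses some `X` that separates `U` from `W`, or some row of `R` is a cut
which has `U` and `W` on the same side. -/
def SplitOrCut {ι V : Type*} (P N : ι → Finset V) (R : Finset ι) (U W : Finset V) : Prop :=
  (∃ X : Set V, (∀ j ∈ R, RowInside P N j X ∨ RowInside P N j Xᶜ) ∧
    (∀ v ∈ U, v ∈ X) ∧ ∀ v ∈ W, v ∉ X) ∨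
  ∃ i X Q Q', IsCut P N R i X Q Q' ∧ (∀ v ∈ U, v ∉ X) ∧ ∀ v ∈ W, v ∉ X

section

variable {ι V : Type*} {P N : ι → Finset V}

theorem IsCut.symm {R : Finset ι} {i : ι} {X : Set V} {Q Q' : Finset V}
    (h : IsCut P N R i X Q Q') : IsCut P N R i Xᶜ Q' Q where
  mem := h.mem
  subset := h.subset_compl
  subset_compl := fun v hv hvX => hvX (h.subset v hv)
  sides := by have := h.sides; tauto
  rows := fun j hj hji => by rw [compl_compl]; exact (h.rows j hj hji).symm

theorem SplitOrCut.symm {R : Finset ι} {U W : Finset V} (h : SplitOrCut P N R U W) :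
    SplitOrCut P N R W U := by
  rcases h with ⟨X, h, hU, hW⟩ | ⟨i, X, Q, Q', h, hU, hW⟩
  · refine Or.inl ⟨Xᶜ, fun j hj => ?_, hW, fun v hv hvX => hvX (hU v hv)⟩
    rw [compl_compl]
    exact (h j hj).symm
  · exact Or.inr ⟨i, X, Q, Q', h, hW, hU⟩

theorem Separated.symm [DecidableEq V] {R : Finset ι} {U W : Finset V} (h : Separated P N R U W) :
    Separated P N R W U := fun J hW hU => h J hU hW

theorem mixedRows_mono [DecidableEq V] {R R' : Finset ι} {J J' : Finset V} (hR : R ⊆ R')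
    (hJ : J ⊆ J') :
    mixedRows P N R J ⊆ mixedRows P N R' J' := by
  intro i hi
  simp only [mixedRows, Finset.mem_filter] at hi ⊢
  exact ⟨hR hi.1, fun h => hi.2.1 (h.mono_right hJ), fun h => hi.2.2 (h.mono_right hJ)⟩

theorem Dominating.mono [DecidableEq V] {R R' : Finset ι} (h : Dominating P N R) (hR : R' ⊆ R) :
    Dominating P N R' := fun J hJ =>
  (Finset.card_le_card (mixedRows_mono hR subset_rfl)).trans_lt (h J hJ)

theorem Separated.mono [DecidableEq V] {R R' : Finset ι} {U W U' W' : Finset V}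
    (h : Separated P N R U W) (hR : R' ⊆ R) (hU : U' ⊆ U) (hW : W' ⊆ W) : Separated P N R' U' W' :=
  fun J hJU hJW =>
  (Nat.add_le_add_right (Finset.card_le_card (mixedRows_mono hR subset_rfl)) 1).trans_lt
    (h J (fun hd => hJU (hd.mono_left hU)) (fun hd => hJW (hd.mono_left hW)))

theorem Separated.union_right [DecidableEq V] {R : Finset ι} {U W W' : Finset V}
    (h : Separated P N R U W) (h' : Separated P N R U W') : Separated P N R U (W ∪ W') := by
  intro J hU hW
  rw [Finset.disjoint_union_left, not_and_or] at hW
  exact hW.elim (h J hU) (h' J hU)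

/-- Removing a row `i` from a dominating family leaves a family in which the two sides of `i` are
separated. -/
theorem Dominating.separated_erase [DecidableEq ι] [DecidableEq V] {R : Finset ι}
    (h : Dominating P N R) {i : ι} (hi : i ∈ R) : Separated P N (R.erase i) (P i) (N i) := by
  intro J hP hN
  have hJ : J.Nonempty := by
    rw [Finset.nonempty_iff_ne_empty]
    rintro rfl
    exact hP (Finset.disjoint_empty_right _)
  refine lt_of_le_of_lt ?_ (h J hJ)
  have hmem : i ∈ mixedRows P N R J := by simp [mixedRows, hi, hP, hN]
  have hsub : mixedRows P N (R.erase i) J ⊆ (mixedRows P N R J).erase i := by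
    intro j hj
    simp only [mixedRows, Finset.mem_filter, Finset.mem_erase] at hj ⊢
    tauto
  have := Finset.card_le_card hsub
  rw [Finset.card_erase_of_mem hmem] at this
  have hpos := Finset.card_pos.2 ⟨i, hmem⟩
  omega

/-- A failure of separation is witnessed inside any `X` that contains the rows and one of the two
sets. -/
theorem exists_tight_of_not_separated [DecidableEq V] {R : Finset ι} {U W : Finset V} {X : Set V}
    (hR : ∀ i ∈ R, RowInside P N i X) (hU : ∀ v ∈ U, v ∈ X) (hW : ∀ v ∈ W, v ∈ X)
    (h : ¬ Separated P N R U W) : ∃ J : Finset V, (∀ v ∈ J, v ∈ X) ∧ ¬ Disjoint U J ∧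
      ¬ Disjoint W J ∧ J.card ≤ (mixedRows P N R J).card + 1 := by
  classical
  simp only [Separated, not_forall, not_lt] at h
  obtain ⟨J, hJU, hJW, hJ⟩ := h
  have key : ∀ T : Finset V, (∀ v ∈ T, v ∈ X) → ¬ Disjoint T J →
      ¬ Disjoint T (J.filter (· ∈ X)) := by
    intro T hT hTJ
    rw [Finset.not_disjoint_iff] at hTJ ⊢
    obtain ⟨a, haT, haJ⟩ := hTJ
    exact ⟨a, haT, Finset.mem_filter.2 ⟨haJ, hT a haT⟩⟩
  refine ⟨J.filter (· ∈ X), fun v hv => (Finset.mem_filter.1 hv).2, key U hU hJU, key W hW hJW, ?_⟩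
  refine (Finset.card_filter_le _ _).trans (hJ.trans (Nat.add_le_add_right ?_ 1))
  refine Finset.card_le_card fun i hi => ?_
  simp only [mixedRows, Finset.mem_filter] at hi ⊢
  exact ⟨hi.1, key _ (hR i hi.1).1 hi.2.1, key _ (hR i hi.1).2 hi.2.2⟩

/-- If a new row with sides `U`, `W` keeps `R` dominating, then it cannot, together with the cut
row `i`, close a cycle that passes through both sides of the cut. -/
theorem IsCut.separated_or_separated [DecidableEq V] {R R₁ R₂ : Finset ι} {i : ι} {X : Set V}
    {Q Q' U W U₁ W₂ : Finset V} (hc : IsCut P N R i X Q Q') (hsep : Separated P N R U W)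
    (hR₁ : R₁ ⊆ R) (hR₂ : R₂ ⊆ R) (hi₁ : i ∉ R₁) (hi₂ : i ∉ R₂) (hdisj : Disjoint R₁ R₂)
    (h₁ : ∀ j ∈ R₁, RowInside P N j X) (h₂ : ∀ j ∈ R₂, RowInside P N j Xᶜ)
    (hU₁ : U₁ ⊆ U) (hU₁X : ∀ v ∈ U₁, v ∈ X) (hW₂ : W₂ ⊆ W) (hW₂X : ∀ v ∈ W₂, v ∉ X) :
    Separated P N R₁ U₁ Q ∨ Separated P N R₂ W₂ Q' := by
  classical
  by_contra! hcon
  obtain ⟨J₁, hJ₁X, hJ₁U, hJ₁Q, hJ₁⟩ := exists_tight_of_not_separated h₁ hU₁X hc.subset hcon.1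
  obtain ⟨J₂, hJ₂X, hJ₂W, hJ₂Q, hJ₂⟩ := exists_tight_of_not_separated h₂ hW₂X hc.subset_compl hcon.2
  -- On `J₁ ∪ J₂` the mixed rows are those of `J₁`, those of `J₂` and the cut row.
  have hJd : Disjoint J₁ J₂ := by
    rw [Finset.disjoint_left]
    exact fun v hv hv' => hJ₂X v hv' (hJ₁X v hv)
  have hl : J₁ ⊆ J₁ ∪ J₂ := Finset.subset_union_left
  have hr : J₂ ⊆ J₁ ∪ J₂ := Finset.subset_union_right
  have hlt := hsep (J₁ ∪ J₂) (fun h => hJ₁U (h.mono hU₁ hl)) (fun h => hJ₂W (h.mono hW₂ hr))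
  have hmem : i ∈ mixedRows P N R (J₁ ∪ J₂) := by
    have hQ : ¬ Disjoint Q (J₁ ∪ J₂) := fun h => hJ₁Q (h.mono_right hl)
    have hQ' : ¬ Disjoint Q' (J₁ ∪ J₂) := fun h => hJ₂Q (h.mono_right hr)
    simp only [mixedRows, Finset.mem_filter]
    rcases hc.sides with ⟨rfl, rfl⟩ | ⟨rfl, rfl⟩
    · exact ⟨hc.mem, hQ, hQ'⟩
    · exact ⟨hc.mem, hQ', hQ⟩
  have hsub : insert i (mixedRows P N R₁ J₁ ∪ mixedRows P N R₂ J₂) ⊆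
      mixedRows P N R (J₁ ∪ J₂) :=
    Finset.insert_subset hmem (Finset.union_subset (mixedRows_mono hR₁ hl) (mixedRows_mono hR₂ hr))
  have hm₁ : mixedRows P N R₁ J₁ ⊆ R₁ := Finset.filter_subset _ _
  have hm₂ : mixedRows P N R₂ J₂ ⊆ R₂ := Finset.filter_subset _ _
  have hcard := Finset.card_le_card hsub
  rw [Finset.card_insert_of_notMem, Finset.card_union_of_disjoint (hdisj.mono hm₁ hm₂)] at hcard
  · rw [Finset.card_union_of_disjoint hJd] at hlt
    omega
  · rw [Finset.mem_union]
    exact fun h => h.elim (fun h => hi₁ (hm₁ h)) (fun h => hi₂ (hm₂ h))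

/-- A cut of the rows that lie in `X` is a cut of all rows, provided that the other rows
avoid its part in `X`. -/
theorem IsCut.lift {R R₁ : Finset ι} {j : ι} {X Y : Set V} {Q Q' : Finset V}
    (hc : IsCut P N R₁ j Y Q Q') (hR₁ : R₁ ⊆ R) (h₁ : ∀ k ∈ R₁, RowInside P N k X)
    (hrest : ∀ k ∈ R, k ∉ R₁ → RowInside P N k (Y ∩ X)ᶜ) :
    IsCut P N R j (Y ∩ X) Q Q' where
  mem := hR₁ hc.mem
  subset := fun v hv => by
    have hj := h₁ j hc.mem
    refine ⟨hc.subset v hv, ?_⟩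
    rcases hc.sides with ⟨rfl, rfl⟩ | ⟨rfl, rfl⟩
    · exact hj.1 v hv
    · exact hj.2 v hv
  subset_compl := fun v hv hvY => hc.subset_compl v hv hvY.1
  sides := hc.sides
  rows := fun k hk hkj => by
    by_cases hk₁ : k ∈ R₁
    · have hkX := h₁ k hk₁
      rcases hc.rows k hk₁ hkj with h | h
      · exact Or.inl ⟨fun v hv => ⟨h.1 v hv, hkX.1 v hv⟩, fun v hv => ⟨h.2 v hv, hkX.2 v hv⟩⟩
      · exact Or.inr ⟨fun v hv hvY => h.1 v hv hvY.1, fun v hv hvY => h.2 v hv hvY.1⟩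
    · exact Or.inr (hrest k hk hk₁)

open Classical in
/-- The rows of `R` inside `X`. -/
noncomputable def rowsInside (P N : ι → Finset V) (R : Finset ι) (X : Set V) : Finset ι :=
  R.filter fun j => RowInside P N j X

open Classical in
/-- The part of `U` inside `X`. -/
noncomputable def part (U : Finset V) (X : Set V) : Finset V := U.filter (· ∈ X)

theorem mem_part {U : Finset V} {X : Set V} {v : V} : v ∈ part U X ↔ v ∈ U ∧ v ∈ X := by
  simp [part]

end

section

variable {ι V : Type*} {P N : ι → Finset V}

theorem mem_rowsInside {R : Finset ι} {X : Set V} {j : ι} :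
    j ∈ rowsInside P N R X ↔ j ∈ R ∧ RowInside P N j X := by
  simp [rowsInside]

theorem rowsInside_subset {R : Finset ι} {X : Set V} : rowsInside P N R X ⊆ R :=
  fun _ hj => (mem_rowsInside.1 hj).1

theorem part_subset {U : Finset V} {X : Set V} : part U X ⊆ U := fun _ hv => (mem_part.1 hv).1

/-- A cut row has entries on both sides of the cut. -/
theorem IsCut.notMem_rowsInside {R : Finset ι} {i : ι} {X : Set V} {Q Q' : Finset V}
    (hc : IsCut P N R i X Q Q') (hne : ∀ j ∈ R, (P j).Nonempty ∧ (N j).Nonempty) :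
    i ∉ rowsInside P N R X := by
  intro hi
  have hX := (mem_rowsInside.1 hi).2
  have hn := hne i hc.mem
  rcases hc.sides with ⟨-, rfl⟩ | ⟨-, rfl⟩
  · obtain ⟨v, hv⟩ := hn.2
    exact hc.subset_compl v hv (hX.2 v hv)
  · obtain ⟨v, hv⟩ := hn.1
    exact hc.subset_compl v hv (hX.1 v hv)

theorem IsCut.rowsInside_card_lt {R : Finset ι} {i : ι} {X : Set V} {Q Q' : Finset V}
    (hc : IsCut P N R i X Q Q') (hne : ∀ j ∈ R, (P j).Nonempty ∧ (N j).Nonempty) :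
    (rowsInside P N R X).card < R.card :=
  Finset.card_lt_card (Finset.ssubset_iff_subset_ne.2 ⟨rowsInside_subset, fun h =>
    hc.notMem_rowsInside hne (h.symm.subset hc.mem)⟩)

theorem disjoint_rowsInside_compl {R : Finset ι} {X : Set V}
    (hne : ∀ j ∈ R, (P j).Nonempty ∧ (N j).Nonempty) :
    Disjoint (rowsInside P N R X) (rowsInside P N R Xᶜ) := by
  rw [Finset.disjoint_left]
  intro j hj hj'
  rw [mem_rowsInside] at hj hj'
  obtain ⟨v, hv⟩ := (hne j hj.1).1
  exact hj'.2.1 v hv (hj.2.1 v hv)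

/-- A cut of the rows on one side of the cut row `i` which avoids the corresponding side `Q` of `i`
is a cut of all rows. -/
theorem SplitOrCut.of_cut_inside {R : Finset ι} {i j : ι} {X Y : Set V} {Q Q' T T' U W : Finset V}
    (hc : IsCut P N R i X Q Q') (hj : IsCut P N (rowsInside P N R X) j Y T T')
    (hQ : ∀ v ∈ Q, v ∉ Y) (hU : ∀ v ∈ part U X, v ∉ Y) (hW : ∀ v ∈ part W X, v ∉ Y) :
    SplitOrCut P N R U W := by
  refine Or.inr ⟨j, Y ∩ X, T, T', hj.lift rowsInside_subset (fun k hk => (mem_rowsInside.1 hk).2)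
    fun k hk hk₁ => ?_, fun v hv hvY => hU v (mem_part.2 ⟨hv, hvY.2⟩) hvY.1,
    fun v hv hvY => hW v (mem_part.2 ⟨hv, hvY.2⟩) hvY.1⟩
  by_cases hki : k = i
  · subst hki
    have h1 : ∀ v ∈ Q, v ∈ (Y ∩ X)ᶜ := fun v hv hvY => hQ v hv hvY.1
    have h2 : ∀ v ∈ Q', v ∈ (Y ∩ X)ᶜ := fun v hv hvY => hc.subset_compl v hv hvY.2
    rcases hc.sides with ⟨rfl, rfl⟩ | ⟨rfl, rfl⟩
    · exact ⟨h1, h2⟩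
    · exact ⟨h2, h1⟩
  · rcases hc.rows k hk hki with h | h
    · exact absurd (mem_rowsInside.2 ⟨hk, h⟩) hk₁
    · exact ⟨fun v hv hvY => h.1 v hv hvY.2, fun v hv hvY => h.2 v hv hvY.2⟩

theorem SplitOrCut.exists_isCut [DecidableEq ι] {R : Finset ι} {i : ι} (hi : i ∈ R)
    (h : SplitOrCut P N (R.erase i) (P i) (N i)) : ∃ j X Q Q', IsCut P N R j X Q Q' := by
  rcases h with ⟨X, hX, hU, hW⟩ | ⟨j, X, Q, Q', hc, hU, hW⟩
  · exact ⟨i, X, P i, N i, hi, hU, hW, Or.inl ⟨rfl, rfl⟩, fun j hj hji =>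
      hX j (Finset.mem_erase.2 ⟨hji, hj⟩)⟩
  · refine ⟨j, X, Q, Q', Finset.mem_of_mem_erase hc.mem, hc.subset, hc.subset_compl, hc.sides,
      fun k hk hkj => ?_⟩
    by_cases hki : k = i
    · subst hki
      exact Or.inr ⟨hU, hW⟩
    · exact hc.rows k (Finset.mem_erase.2 ⟨hki, hk⟩) hkj

theorem RowInside.ite_left {i : ι} {X Y Y' : Set V} (h : RowInside P N i X)
    (hY : RowInside P N i Y ∨ RowInside P N i Yᶜ) :
    RowInside P N i (X.ite Y Y') ∨ RowInside P N i (X.ite Y Y')ᶜ := by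
  refine hY.imp (fun h' => ⟨fun v hv => Or.inl ⟨h'.1 v hv, h.1 v hv⟩,
    fun v hv => Or.inl ⟨h'.2 v hv, h.2 v hv⟩⟩) fun h' => ⟨fun v hv hv' => ?_, fun v hv hv' => ?_⟩
  · exact hv'.elim (fun a => h'.1 v hv a.1) (fun a => a.2 (h.1 v hv))
  · exact hv'.elim (fun a => h'.2 v hv a.1) (fun a => a.2 (h.2 v hv))

theorem RowInside.ite_right {i : ι} {X Y Y' : Set V} (h : RowInside P N i Xᶜ)
    (hY : RowInside P N i Y' ∨ RowInside P N i Y'ᶜ) :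
    RowInside P N i (X.ite Y Y') ∨ RowInside P N i (X.ite Y Y')ᶜ := by
  refine hY.imp (fun h' => ⟨fun v hv => Or.inr ⟨h'.1 v hv, h.1 v hv⟩,
    fun v hv => Or.inr ⟨h'.2 v hv, h.2 v hv⟩⟩) fun h' => ⟨fun v hv hv' => ?_, fun v hv hv' => ?_⟩
  · exact hv'.elim (fun a => h.1 v hv a.2) (fun a => h'.1 v hv a.1)
  · exact hv'.elim (fun a => h.2 v hv a.2) (fun a => h'.2 v hv a.1)

/-- If no row crosses `Z`, the two sides of `Z` can be treated separately. -/
theorem SplitOrCut.of_uncrossed {R : Finset ι} {Z : Set V} {U W : Finset V}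
    (hZ : ∀ j ∈ R, RowInside P N j Z ∨ RowInside P N j Zᶜ)
    (h₁ : SplitOrCut P N (rowsInside P N R Z) (part U Z) (part W Z))
    (h₂ : SplitOrCut P N (rowsInside P N R Zᶜ) (part U Zᶜ) (part W Zᶜ)) :
    SplitOrCut P N R U W := by
  have cut : ∀ Z : Set V, (∀ j ∈ R, RowInside P N j Z ∨ RowInside P N j Zᶜ) →
      (∃ i X Q Q', IsCut P N (rowsInside P N R Z) i X Q Q' ∧ (∀ v ∈ part U Z, v ∉ X) ∧
        ∀ v ∈ part W Z, v ∉ X) → SplitOrCut P N R U W := by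
    rintro Z hZ ⟨j, Y, T, T', hj, hU, hW⟩
    refine Or.inr ⟨j, Y ∩ Z, T, T', hj.lift rowsInside_subset (fun k hk => (mem_rowsInside.1 hk).2)
      fun k hk hk₁ => ?_, fun v hv hvY => hU v (mem_part.2 ⟨hv, hvY.2⟩) hvY.1,
      fun v hv hvY => hW v (mem_part.2 ⟨hv, hvY.2⟩) hvY.1⟩
    rcases hZ k hk with h | h
    · exact absurd (mem_rowsInside.2 ⟨hk, h⟩) hk₁
    · exact ⟨fun v hv hvY => h.1 v hv hvY.2, fun v hv hvY => h.2 v hv hvY.2⟩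
  rcases h₁ with ⟨Y, hY, hYU, hYW⟩ | h₁
  · rcases h₂ with ⟨Y', hY', hYU', hYW'⟩ | h₂
    · refine Or.inl ⟨Z.ite Y Y', fun j hj => ?_, fun v hv => ?_, fun v hv => ?_⟩
      · rcases hZ j hj with h | h
        · exact h.ite_left (hY j (mem_rowsInside.2 ⟨hj, h⟩))
        · exact h.ite_right (hY' j (mem_rowsInside.2 ⟨hj, h⟩))
      · by_cases hvZ : v ∈ Z
        · exact Or.inl ⟨hYU v (mem_part.2 ⟨hv, hvZ⟩), hvZ⟩
        · exact Or.inr ⟨hYU' v (mem_part.2 ⟨hv, hvZ⟩), hvZ⟩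
      · rintro (⟨hvY, hvZ⟩ | ⟨hvY, hvZ⟩)
        · exact hYW v (mem_part.2 ⟨hv, hvZ⟩) hvY
        · exact hYW' v (mem_part.2 ⟨hv, hvZ⟩) hvY
    · exact cut Zᶜ (fun j hj => by rw [compl_compl]; exact (hZ j hj).symm) h₂
  · exact cut Z hZ h₁

theorem part_card_add_lt {U W : Finset V} {Z : Set V} (h : ∃ v, (v ∈ U ∨ v ∈ W) ∧ v ∉ Z) :
    (part U Z).card + (part W Z).card < U.card + W.card := by
  obtain ⟨v, hv | hv, hvZ⟩ := h
  · exact Nat.add_lt_add_of_lt_of_le (Finset.card_lt_card (Finset.ssubset_iff_subset_ne.2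
      ⟨part_subset, fun h => hvZ (mem_part.1 (h ▸ hv)).2⟩)) (Finset.card_le_card part_subset)
  · exact Nat.add_lt_add_of_le_of_lt (Finset.card_le_card part_subset) (Finset.card_lt_card
      (Finset.ssubset_iff_subset_ne.2 ⟨part_subset, fun h => hvZ (mem_part.1 (h ▸ hv)).2⟩))

/-- The inductive step when, on one side of the cut row `i`, neither `U` nor `W` is linked to `i`.
There one splits off the part of `X` that contains `U` and `W`. -/
theorem IsCut.splitOrCut_of_same [DecidableEq V] {R : Finset ι} {i : ι} {X : Set V}
    {Q Q' U W : Finset V} (hc : IsCut P N R i X Q Q')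
    (hQU : Separated P N (rowsInside P N R X) Q (part U X))
    (hQW : Separated P N (rowsInside P N R X) Q (part W X))
    (hX : ∀ U' W', Separated P N (rowsInside P N R X) U' W' →
      SplitOrCut P N (rowsInside P N R X) U' W')
    (hZ : ∀ Z : Set V, (∃ v, (v ∈ U ∨ v ∈ W) ∧ v ∉ Z) →
      SplitOrCut P N (rowsInside P N R Z) (part U Z) (part W Z)) :
    SplitOrCut P N R U W := by
  rcases hX _ _ (hQU.union_right hQW) with ⟨Y, hY, hYQ, hYUW⟩ | ⟨j, Y, T, T', hj, hQ, hUW⟩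
  · by_cases hempty : ∃ v, (v ∈ U ∨ v ∈ W) ∧ v ∈ X
    · by_cases hfull : ∃ v, (v ∈ U ∨ v ∈ W) ∧ v ∉ X
      · -- No row crosses `X \ Y`, and `U ∪ W` has fewer elements on either side of it.
        have hrows : ∀ j ∈ R, RowInside P N j (X \ Y) ∨ RowInside P N j (X \ Y)ᶜ := by
          intro k hk
          by_cases hki : k = i
          · subst hki
            have h1 : ∀ v ∈ Q, v ∈ (X \ Y)ᶜ := fun v hv hvY => hvY.2 (hYQ v hv)
            have h2 : ∀ v ∈ Q', v ∈ (X \ Y)ᶜ := fun v hv hvY => hc.subset_compl v hv hvY.1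
            rcases hc.sides with ⟨rfl, rfl⟩ | ⟨rfl, rfl⟩
            · exact Or.inr ⟨h1, h2⟩
            · exact Or.inr ⟨h2, h1⟩
          · rcases hc.rows k hk hki with h | h
            · rcases hY k (mem_rowsInside.2 ⟨hk, h⟩) with h' | h'
              · exact Or.inr ⟨fun v hv hvY => hvY.2 (h'.1 v hv), fun v hv hvY => hvY.2 (h'.2 v hv)⟩
              · exact Or.inl ⟨fun v hv => ⟨h.1 v hv, h'.1 v hv⟩, fun v hv => ⟨h.2 v hv, h'.2 v hv⟩⟩
            · exact Or.inr ⟨fun v hv hvY => h.1 v hv hvY.1, fun v hv hvY => h.2 v hv hvY.1⟩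
        refine SplitOrCut.of_uncrossed hrows (hZ _ ?_) (hZ _ ?_)
        · obtain ⟨v, hv, hvX⟩ := hfull
          exact ⟨v, hv, fun h => hvX h.1⟩
        · obtain ⟨v, hv, hvX⟩ := hempty
          refine ⟨v, hv, fun h => h ⟨hvX, hYUW v ?_⟩⟩
          rw [Finset.mem_union, mem_part, mem_part]
          exact hv.imp (fun h => ⟨h, hvX⟩) (fun h => ⟨h, hvX⟩)
      · push Not at hfull
        exact Or.inr ⟨i, Xᶜ, Q', Q, hc.symm, fun v hv h => h (hfull v (Or.inl hv)),
          fun v hv h => h (hfull v (Or.inr hv))⟩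
    · push Not at hempty
      exact Or.inr ⟨i, X, Q, Q', hc, fun v hv => hempty v (Or.inl hv),
        fun v hv => hempty v (Or.inr hv)⟩
  · exact SplitOrCut.of_cut_inside hc hj hQ (fun v hv => hUW v (Finset.mem_union_left _ hv))
      (fun v hv => hUW v (Finset.mem_union_right _ hv))

/-- The inductive step when `U` is not linked to the cut row `i` on either side: one separates `U`
from both `W` and `i`, on each side of the cut. -/
theorem IsCut.splitOrCut_of_both [DecidableEq V] {R : Finset ι} {i : ι} {X : Set V}
    {Q Q' U W : Finset V} (hc : IsCut P N R i X Q Q') (hsep : Separated P N R U W)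
    (hUQ : Separated P N (rowsInside P N R X) (part U X) Q)
    (hUQ' : Separated P N (rowsInside P N R Xᶜ) (part U Xᶜ) Q')
    (hX : ∀ U' W', Separated P N (rowsInside P N R X) U' W' →
      SplitOrCut P N (rowsInside P N R X) U' W')
    (hX' : ∀ U' W', Separated P N (rowsInside P N R Xᶜ) U' W' →
      SplitOrCut P N (rowsInside P N R Xᶜ) U' W') :
    SplitOrCut P N R U W := by
  have h₁ := hX _ _ (hUQ.union_right (hsep.mono rowsInside_subset part_subset
    (part_subset (U := W) (X := X))))
  have h₂ := hX' _ _ (hUQ'.union_right (hsep.mono rowsInside_subset part_subset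
    (part_subset (U := W) (X := Xᶜ))))
  rcases h₁ with ⟨Y, hY, hYU, hYQW⟩ | ⟨j, Y, T, T', hj, hU, hQW⟩
  · rcases h₂ with ⟨Y', hY', hYU', hYQW'⟩ | ⟨j, Y, T, T', hj, hU, hQW⟩
    · -- `U` is split off on both sides of the cut, and the cut row stays together with `W`.
      refine Or.inl ⟨X.ite Y Y', fun j hj => ?_, fun v hv => ?_, fun v hv => ?_⟩
      · by_cases hji : j = i
        · subst hji
          have h1 : ∀ v ∈ Q, v ∉ X.ite Y Y' := by
            rintro v hv (⟨h, -⟩ | ⟨-, h⟩)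
            · exact hYQW v (Finset.mem_union_left _ hv) h
            · exact h (hc.subset v hv)
          have h2 : ∀ v ∈ Q', v ∉ X.ite Y Y' := by
            rintro v hv (⟨-, h⟩ | ⟨h, -⟩)
            · exact hc.subset_compl v hv h
            · exact hYQW' v (Finset.mem_union_left _ hv) h
          rcases hc.sides with ⟨rfl, rfl⟩ | ⟨rfl, rfl⟩
          · exact Or.inr ⟨h1, h2⟩
          · exact Or.inr ⟨h2, h1⟩
        · rcases hc.rows j hj hji with h | h
          · exact h.ite_left (hY j (mem_rowsInside.2 ⟨hj, h⟩))
          · exact h.ite_right (hY' j (mem_rowsInside.2 ⟨hj, h⟩))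
      · by_cases hvX : v ∈ X
        · exact Or.inl ⟨hYU v (mem_part.2 ⟨hv, hvX⟩), hvX⟩
        · exact Or.inr ⟨hYU' v (mem_part.2 ⟨hv, hvX⟩), hvX⟩
      · rintro (⟨hvY, hvX⟩ | ⟨hvY, hvX⟩)
        · exact hYQW v (Finset.mem_union_right _ (mem_part.2 ⟨hv, hvX⟩)) hvY
        · exact hYQW' v (Finset.mem_union_right _ (mem_part.2 ⟨hv, hvX⟩)) hvY
    · exact SplitOrCut.of_cut_inside hc.symm hj (fun v hv => hQW v (Finset.mem_union_left _ hv)) hU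
        (fun v hv => hQW v (Finset.mem_union_right _ hv))
  · exact SplitOrCut.of_cut_inside hc hj (fun v hv => hQW v (Finset.mem_union_left _ hv)) hU
      (fun v hv => hQW v (Finset.mem_union_right _ hv))

/-- Rows with two nonempty sides that form a dominating family have a split or a cut for every pair
of separated sets. The induction is on the number of rows, then on the size of `U` and `W`: a cut
row of `R` exists by the induction hypothesis for `R` without one of its rows, and each of `U`,
`W` is unlinked to it on at least one side. -/
theorem Dominating.splitOrCut [DecidableEq V] {R : Finset ι} (hdom : Dominating P N R)
    (hne : ∀ j ∈ R, (P j).Nonempty ∧ (N j).Nonempty) {U W : Finset V}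
    (hsep : Separated P N R U W) : SplitOrCut P N R U W := by
  classical
  induction hn : R.card using Nat.strong_induction_on generalizing R U W with
  | _ n ihR =>
  induction hk : U.card + W.card using Nat.strong_induction_on generalizing R U W with
  | _ k ihU =>
  rcases R.eq_empty_or_nonempty with rfl | ⟨i₀, hi₀⟩
  · refine Or.inl ⟨(U : Set V), by simp, fun v hv => hv, fun v hv hvU => ?_⟩
    have := hsep {v} (by simpa using hvU) (by simpa using hv)
    simp at this
  obtain ⟨i, X, Q, Q', hc⟩ := (ihR _ (hn ▸ Finset.card_erase_lt_of_mem hi₀)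
    (hdom.mono (Finset.erase_subset _ _)) (fun j hj => hne j (Finset.mem_of_mem_erase hj))
    (hdom.separated_erase hi₀) rfl).exists_isCut hi₀
  have ihX : ∀ {X : Set V} {Q Q' : Finset V}, IsCut P N R i X Q Q' → ∀ U' W',
      Separated P N (rowsInside P N R X) U' W' → SplitOrCut P N (rowsInside P N R X) U' W' :=
    fun hc U' W' h => ihR _ (hn ▸ hc.rowsInside_card_lt hne) (hdom.mono rowsInside_subset)
      (fun j hj => hne j (rowsInside_subset hj)) h rfl
  have ihZ : ∀ Z : Set V, (∃ v, (v ∈ U ∨ v ∈ W) ∧ v ∉ Z) →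
      SplitOrCut P N (rowsInside P N R Z) (part U Z) (part W Z) := by
    intro Z hZ
    have hsepZ := hsep.mono (rowsInside_subset (P := P) (N := N) (X := Z))
      (part_subset (U := U) (X := Z))
      (part_subset (U := W) (X := Z))
    have hneZ : ∀ j ∈ rowsInside P N R Z, (P j).Nonempty ∧ (N j).Nonempty :=
      fun j hj => hne j (rowsInside_subset hj)
    rcases (Finset.card_le_card (rowsInside_subset (P := P) (N := N) (R := R)
      (X := Z))).lt_or_eq with hlt | heq
    · exact ihR _ (hn ▸ hlt) (hdom.mono rowsInside_subset) hneZ hsepZ rfl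
    · -- All rows of `R` lie in `Z`, but a part of `U ∪ W` does not.
      exact ihU _ (hk ▸ part_card_add_lt hZ) (hdom.mono rowsInside_subset) hneZ hsepZ
        (heq.trans hn) rfl
  have linked : ∀ {U W : Finset V}, Separated P N R U W →
      Separated P N (rowsInside P N R X) (part U X) Q ∨
        Separated P N (rowsInside P N R Xᶜ) (part W Xᶜ) Q' := fun h =>
    hc.separated_or_separated h rowsInside_subset rowsInside_subset (hc.notMem_rowsInside hne)
      (hc.symm.notMem_rowsInside hne) (disjoint_rowsInside_compl hne)
      (fun j hj => (mem_rowsInside.1 hj).2) (fun j hj => (mem_rowsInside.1 hj).2)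
      part_subset (fun v hv => (mem_part.1 hv).2) part_subset (fun v hv => (mem_part.1 hv).2)
  rcases linked hsep with hU | hW'
  · rcases linked hsep.symm with hW | hU'
    · exact hc.splitOrCut_of_same hU.symm hW.symm (ihX hc) ihZ
    · exact hc.splitOrCut_of_both hsep hU hU' (ihX hc) (ihX hc.symm)
  · rcases linked hsep.symm with hW | hU'
    · exact (hc.splitOrCut_of_both hsep.symm hW hW' (ihX hc) (ihX hc.symm)).symm
    · exact hc.symm.splitOrCut_of_same hU'.symm hW'.symm (ihX hc.symm) ihZ

/-- A nonempty dominating family of rows with two nonempty sides has a cut. -/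
theorem Dominating.exists_isCut [DecidableEq V] {R : Finset ι} (hdom : Dominating P N R)
    (hne : ∀ j ∈ R, (P j).Nonempty ∧ (N j).Nonempty) (hR : R.Nonempty) :
    ∃ i X Q Q', IsCut P N R i X Q Q' := by
  classical
  obtain ⟨i₀, hi₀⟩ := hR
  exact ((hdom.mono (Finset.erase_subset _ _)).splitOrCut
    (fun j hj => hne j (Finset.mem_of_mem_erase hj)) (hdom.separated_erase hi₀)).exists_isCut hi₀

end


/-! ### Toric ideals and their height -/

/-- Reduction of exponent vectors modulo a subspace `W` of `ℚ^σ`. -/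
noncomputable def expHom {σ : Type*} (W : Submodule ℚ (σ → ℚ)) :
    (σ →₀ ℕ) →+ (σ → ℚ) ⧸ W where
  toFun x := W.mkQ fun a => (x a : ℚ)
  map_zero' := by
    rw [← map_zero W.mkQ]
    congr 1
  map_add' x y := by
    rw [← map_add]
    congr 1
    ext a
    simp

theorem expHom_eq_iff {σ : Type*} {W : Submodule ℚ (σ → ℚ)} {x y : σ →₀ ℕ} :
    expHom W x = expHom W y ↔ (fun a => (x a : ℚ) - y a) ∈ W :=
  Submodule.Quotient.eq W

/-- The toric ideal of a subspace `W` of `ℚ^σ`: the kernel of the reduction of exponents modulo `W`.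
It is spanned by the binomials whose exponent vectors agree modulo `W`. -/
noncomputable def toricIdeal {σ : Type*} (W : Submodule ℚ (σ → ℚ)) : Ideal (MvPolynomial σ ℚ) :=
  RingHom.ker (AddMonoidAlgebra.mapDomainRingHom ℚ (expHom W))

instance toricIdeal_isPrime {σ : Type*} (W : Submodule ℚ (σ → ℚ)) : (toricIdeal W).IsPrime :=
  RingHom.ker_isPrime _

theorem mapDomainRingHom_monomial {σ M : Type*} [AddCommMonoid M] (ψ : (σ →₀ ℕ) →+ M)
    (x : σ →₀ ℕ) (c : ℚ) :
    AddMonoidAlgebra.mapDomainRingHom ℚ ψ (MvPolynomial.monomial x c) =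
      AddMonoidAlgebra.single (ψ x) c := by
  rw [← MvPolynomial.single_eq_monomial]
  simp

theorem binomial_mem_toricIdeal_iff {σ : Type*} {W : Submodule ℚ (σ → ℚ)} {x y : σ →₀ ℕ} :
    MvPolynomial.monomial x (1 : ℚ) - MvPolynomial.monomial y 1 ∈ toricIdeal W ↔
      (fun a => (x a : ℚ) - y a) ∈ W := by
  rw [← expHom_eq_iff, toricIdeal, RingHom.mem_ker, map_sub, mapDomainRingHom_monomial,
    mapDomainRingHom_monomial, sub_eq_zero]
  exact ⟨fun h => by simpa using AddMonoidAlgebra.single_left_injective one_ne_zero h,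
    fun h => by rw [h]⟩

theorem monomial_notMem_toricIdeal {σ : Type*} {W : Submodule ℚ (σ → ℚ)} {x : σ →₀ ℕ} :
    MvPolynomial.monomial x (1 : ℚ) ∉ toricIdeal W := by
  rw [toricIdeal, RingHom.mem_ker, mapDomainRingHom_monomial]
  simp

/-- The kernel of a map of monoid algebras is spanned by binomials. -/
theorem ker_mapDomainRingHom_le {σ M : Type*} [AddCommMonoid M] (ψ : (σ →₀ ℕ) →+ M)
    {I : Ideal (MvPolynomial σ ℚ)}
    (hI : ∀ x y, ψ x = ψ y → MvPolynomial.monomial x (1 : ℚ) - MvPolynomial.monomial y 1 ∈ I) :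
    RingHom.ker (AddMonoidAlgebra.mapDomainRingHom ℚ ψ) ≤ I := by
  intro f hf
  -- Modulo `I`, every monomial can be replaced by a chosen one with the same image under `ψ`.
  have key : ∀ f : MvPolynomial σ ℚ, f - AddMonoidAlgebra.mapDomain (Function.invFun ψ)
      (AddMonoidAlgebra.mapDomainRingHom ℚ ψ f) ∈ I := by
    intro f
    induction f using MvPolynomial.induction_on' with
    | monomial u c =>
      rw [mapDomainRingHom_monomial, AddMonoidAlgebra.mapDomain_single,
        MvPolynomial.single_eq_monomial]
      have := I.mul_mem_left (MvPolynomial.C c)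
        (hI u (Function.invFun ψ (ψ u)) (Function.invFun_eq ⟨u, rfl⟩).symm)
      simpa [mul_sub, MvPolynomial.C_mul_monomial] using this
    | add p q hp hq =>
      rw [map_add, AddMonoidAlgebra.mapDomain_add, add_sub_add_comm]
      exact I.add_mem hp hq
  have := key f
  rwa [(RingHom.mem_ker).1 hf, AddMonoidAlgebra.mapDomain_zero, sub_zero] at this

theorem toricIdeal_strictMono {σ : Type*} [Fintype σ] :
    StrictMono (toricIdeal (σ := σ)) := by
  intro W W' hlt
  refine lt_of_le_of_ne ?_ ?_
  · refine ker_mapDomainRingHom_le _ fun x y hxy => ?_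
    exact binomial_mem_toricIdeal_iff.2 (hlt.le (expHom_eq_iff.1 hxy))
  · intro heq
    obtain ⟨v, hv', hv⟩ := SetLike.exists_of_lt hlt
    -- After clearing denominators, `v` is a difference of two vectors of natural numbers.
    obtain ⟨b, hb⟩ := IsLocalization.exist_integer_multiples_of_finite (nonZeroDivisors ℤ) v
    choose z hz using hb
    have hb0 : ((b : ℤ) : ℚ) ≠ 0 := by
      exact_mod_cast nonZeroDivisors.coe_ne_zero b
    have hbv : (fun a => ((Finsupp.equivFunOnFinite.symm fun a => (z a).toNat) a : ℚ) -
        (Finsupp.equivFunOnFinite.symm fun a => (-z a).toNat) a) = ((b : ℤ) : ℚ) • v := by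
      ext a
      have h1 := hz a
      simp only [algebraMap_int_eq, eq_intCast, zsmul_eq_mul] at h1
      have h2 : ((z a).toNat : ℚ) - ((-z a).toNat : ℚ) = z a := by
        exact_mod_cast congrArg (Int.cast (R := ℚ)) (Int.toNat_sub_toNat_neg (z a))
      simp only [Finsupp.equivFunOnFinite_symm_apply_apply, Pi.smul_apply, smul_eq_mul]
      rw [h2, h1]
    have hmem := binomial_mem_toricIdeal_iff.2 (hbv ▸ W'.smul_mem _ hv')
    rw [← heq, binomial_mem_toricIdeal_iff, hbv] at hmem
    exact hv ((W.smul_mem_iff hb0).1 hmem)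

/-- A flag of subspaces of `W` gives a chain of toric prime ideals. -/
theorem finrank_le_height_toricIdeal {σ : Type*} [Fintype σ] (W : Submodule ℚ (σ → ℚ)) :
    (Module.finrank ℚ W : ℕ∞) ≤ (toricIdeal W).height := by
  have hmono : StrictMono fun W : Submodule ℚ (σ → ℚ) =>
      (⟨toricIdeal W, inferInstance⟩ : PrimeSpectrum (MvPolynomial σ ℚ)) :=
    fun _ _ h => toricIdeal_strictMono h
  have := Order.height_le_height_apply_of_strictMono _ hmono W
  rwa [← Module.length_submodule, Module.length_eq_finrank,
    ← PrimeSpectrum.height_eq_orderHeight] at this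

/-- If the toric ideal of `W` is generated by `dim W` binomials, then their exponent vectors form a
dominating family: with as many mixed rows as columns in `J`, the ideal
`toricIdeal W + (X_j : j ∈ J)` would be generated by at most `dim W` elements, while its minimal
primes have height more than `dim W`. -/
theorem dominating_of_span_binomials {σ ι : Type*} [Fintype σ] [Fintype ι] [DecidableEq σ]
    (W : Submodule ℚ (σ → ℚ)) (x y : ι → σ →₀ ℕ) (hx : ∀ i, x i ≠ 0) (hy : ∀ i, y i ≠ 0)
    (hspan : toricIdeal W = Ideal.span (Set.range fun i =>
      MvPolynomial.monomial (x i) (1 : ℚ) - MvPolynomial.monomial (y i) 1))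
    (hcard : Fintype.card ι ≤ Module.finrank ℚ W) :
    Dominating (fun i => (x i).support) (fun i => (y i).support) (Finset.univ : Finset ι) := by
  classical
  intro J hJ
  by_contra! hle
  set B : ι → MvPolynomial σ ℚ := fun i =>
    MvPolynomial.monomial (x i) (1 : ℚ) - MvPolynomial.monomial (y i) 1 with hB
  set M := mixedRows (fun i => (x i).support) (fun i => (y i).support) (Finset.univ : Finset ι) J
  set T : Finset (MvPolynomial σ ℚ) := J.image MvPolynomial.X ∪ (Finset.univ \ M).image B with hT
  -- The mixed binomials lie in the ideal of the variables `X_j`, so `T` generates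
  -- `toricIdeal W + (X_j : j ∈ J)`.
  have hTcard : T.card ≤ Fintype.card ι := by
    have h1 : T.card ≤ _ := Finset.card_union_le (J.image (MvPolynomial.X (R := ℚ)))
      ((Finset.univ \ M).image B)
    have h2 := Finset.card_image_le (s := J) (f := MvPolynomial.X (R := ℚ))
    have h3 := Finset.card_image_le (s := Finset.univ \ M) (f := B)
    have h4 := Finset.card_sdiff_add_card_eq_card (Finset.subset_univ M)
    rw [Finset.card_univ] at h4
    omega
  -- All generators vanish at the origin, so the ideal is proper.
  have hTmax : Ideal.span (T : Set (MvPolynomial σ ℚ)) ≤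
      RingHom.ker (MvPolynomial.constantCoeff (σ := σ) (R := ℚ)) := by
    rw [Ideal.span_le]
    intro f hf
    simp only [hT, Finset.coe_union, Finset.coe_image, Set.mem_union, Set.mem_image] at hf
    rcases hf with ⟨j, -, rfl⟩ | ⟨i, -, rfl⟩
    · simp
    · simp [hB, MvPolynomial.constantCoeff_monomial, hx i, hy i]
  have hprime : (RingHom.ker (MvPolynomial.constantCoeff (σ := σ) (R := ℚ))).IsPrime :=
    RingHom.ker_isPrime _
  obtain ⟨p, hp, -⟩ := Ideal.exists_minimalPrimes_le hTmax
  have hpp : p.IsPrime := hp.1.1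
  have hTp : ∀ f ∈ T, f ∈ p := fun f hf => hp.1.2 (Ideal.subset_span hf)
  have hXp : ∀ j ∈ J, MvPolynomial.X j ∈ p := fun j hj =>
    hTp _ (Finset.mem_union_left _ (Finset.mem_image_of_mem _ hj))
  have hmono : ∀ u : σ →₀ ℕ, ¬ Disjoint u.support J → MvPolynomial.monomial u (1 : ℚ) ∈ p := by
    intro u hu
    obtain ⟨j, hju, hjJ⟩ := Finset.not_disjoint_iff.1 hu
    refine p.mem_of_dvd ?_ (hXp j hjJ)
    exact (MvPolynomial.X_dvd_monomial).2 (Or.inr (Finsupp.mem_support_iff.1 hju))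
  have hIp : toricIdeal W ≤ p := by
    rw [hspan, Ideal.span_le]
    rintro _ ⟨i, rfl⟩
    by_cases hi : i ∈ M
    · have hi' := (Finset.mem_filter.1 hi).2
      exact p.sub_mem (hmono _ hi'.1) (hmono _ hi'.2)
    · exact hTp _ (Finset.mem_union_right _ (Finset.mem_image_of_mem B (by simp [hi])))
  have hlt : toricIdeal W < p := by
    refine lt_of_le_of_ne hIp fun heq => ?_
    obtain ⟨j, hj⟩ := hJ
    have := hXp j hj
    rw [← heq] at this
    exact monomial_notMem_toricIdeal this
  have h1 := finrank_le_height_toricIdeal W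
  have h2 := Ideal.height_strict_mono_of_isPrime_of_isPrime hlt
  have h3 := Ideal.height_le_card_of_mem_minimalPrimes_span_finset hp
  have h4 := (h1.trans_lt h2).trans_le h3
  have h5 : Module.finrank ℚ W < T.card := by exact_mod_cast h4
  omega


/-! ### From cuts to gluings -/

section

variable {m : ℕ} {V ι : Type*}

theorem toInt_injective : Function.Injective (toInt (m := m)) := by
  intro a b h
  ext i
  exact Int.ofNat_inj.1 (congrFun h i)

theorem toInt_zero : toInt (0 : Fin m →₀ ℕ) = 0 := by
  ext i
  simp [toInt]

theorem toInt_add (a b : Fin m →₀ ℕ) : toInt (a + b) = toInt a + toInt b := by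
  ext i
  simp [toInt]

theorem toInt_nsmul (n : ℕ) (a : Fin m →₀ ℕ) : toInt (n • a) = (n : ℤ) • toInt a := by
  ext i
  simp [toInt]

/-- The vector `∑ u_v • e v` of `ℤ^m`. -/
noncomputable def evalInt (e : V → Fin m →₀ ℕ) : (V →₀ ℤ) →ₗ[ℤ] Fin m → ℤ :=
  Finsupp.linearCombination ℤ fun v => toInt (e v)

/-- An exponent vector with integer entries. -/
noncomputable def castInt : (V →₀ ℕ) →+ V →₀ ℤ :=
  Finsupp.mapRange.addMonoidHom (Nat.castAddMonoidHom ℤ)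

theorem castInt_apply (x : V →₀ ℕ) (v : V) : castInt x v = x v := by
  simp [castInt]

theorem support_castInt (x : V →₀ ℕ) : (castInt x).support = x.support := by
  ext v
  simp [castInt_apply]

theorem evalInt_castInt (e : V → Fin m →₀ ℕ) (x : V →₀ ℕ) :
    evalInt e (castInt x) = toInt (Finsupp.linearCombination ℕ e x) := by
  induction x using Finsupp.induction_linear with
  | zero => simp [toInt_zero]
  | add x y hx hy => rw [map_add, map_add, map_add, toInt_add, hx, hy]
  | single v n =>
    simp [castInt, evalInt, toInt_nsmul]

/-- The difference `x i - y i` of the two sides of a relation. -/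
noncomputable def rowVec (x y : ι → V →₀ ℕ) (i : ι) : V →₀ ℤ := castInt (x i) - castInt (y i)

theorem linearCombination_mem_closure {e : V → Fin m →₀ ℕ} {C : Set V} {x : V →₀ ℕ}
    (hx : ∀ v ∈ x.support, v ∈ C) :
    Finsupp.linearCombination ℕ e x ∈ AddSubmonoid.closure (e '' C) := by
  rw [Finsupp.linearCombination_apply]
  exact AddSubmonoid.sum_mem _ fun v hv =>
    AddSubmonoid.nsmul_mem _ (AddSubmonoid.subset_closure (Set.mem_image_of_mem e (hx v hv))) _

theorem exists_linearCombination_of_mem_closure {e : V → Fin m →₀ ℕ} {C : Set V}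
    {s : Fin m →₀ ℕ} (hs : s ∈ AddSubmonoid.closure (e '' C)) :
    ∃ x : V →₀ ℕ, (∀ v ∈ x.support, v ∈ C) ∧ Finsupp.linearCombination ℕ e x = s := by
  classical
  induction hs using AddSubmonoid.closure_induction with
  | mem s hs =>
    obtain ⟨v, hv, rfl⟩ := hs
    refine ⟨Finsupp.single v 1, fun w hw => ?_, by simp⟩
    rw [Finset.mem_singleton.1 (Finsupp.support_single_subset hw)]
    exact hv
  | zero => exact ⟨0, by simp, by simp⟩
  | add s t _ _ hs ht =>
    obtain ⟨x, hx, rfl⟩ := hs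
    obtain ⟨y, hy, rfl⟩ := ht
    refine ⟨x + y, fun v hv => ?_, map_add _ _ _⟩
    exact (Finset.mem_union.1 (Finsupp.support_add hv)).elim (hx v) (hy v)

theorem exists_evalInt_of_mem_groupSpan {e : V → Fin m →₀ ℕ} {C : Set V} {z : Fin m → ℤ}
    (hz : z ∈ groupSpan (AddSubmonoid.closure (e '' C))) :
    ∃ u : V →₀ ℤ, (∀ v ∈ u.support, v ∈ C) ∧ evalInt e u = z := by
  classical
  obtain ⟨a, ha, b, hb, rfl⟩ := hz
  obtain ⟨x, hx, rfl⟩ := exists_linearCombination_of_mem_closure ha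
  obtain ⟨y, hy, rfl⟩ := exists_linearCombination_of_mem_closure hb
  refine ⟨castInt x - castInt y, fun v hv => ?_, ?_⟩
  · have := Finsupp.support_sub hv
    rw [support_castInt, support_castInt, Finset.mem_union] at this
    exact this.elim (hx v) (hy v)
  · rw [map_sub, evalInt_castInt, evalInt_castInt]

theorem zsmul_toInt_mem_groupSpan {S : AddSubmonoid (Fin m →₀ ℕ)} {d : Fin m →₀ ℕ} (hd : d ∈ S)
    (k : ℤ) : k • toInt d ∈ groupSpan S := by
  refine ⟨k.toNat • d, S.nsmul_mem hd _, (-k).toNat • d, S.nsmul_mem hd _, ?_⟩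
  rw [toInt_nsmul, toInt_nsmul, ← sub_smul, Int.toNat_sub_toNat_neg]

theorem linearCombination_ne_zero {e : V → Fin m →₀ ℕ} {x : V →₀ ℕ} (hx : x ≠ 0)
    (he : ∀ v ∈ x.support, e v ≠ 0) : Finsupp.linearCombination ℕ e x ≠ 0 := by
  obtain ⟨v, hv⟩ := Finsupp.support_nonempty_iff.2 hx
  intro h
  rw [Finsupp.linearCombination_apply, Finsupp.sum, Finset.sum_eq_zero_iff] at h
  exact (smul_ne_zero (Finsupp.mem_support_iff.1 hv) (he v hv)) (h v hv)

open Classical in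
/-- Restricting an integer combination of the rows to one side of a cut gives a combination of
the rows on that side and of the corresponding side `a` of the cut row; on the other side the
coefficient is the opposite one. -/
theorem IsCut.exists_coeff {x y : ι → V →₀ ℕ} {R : Finset ι} {i : ι} {X : Set V}
    {a b : V →₀ ℕ} (hab : (a = x i ∧ b = y i) ∨ (a = y i ∧ b = x i))
    (hc : IsCut (fun i => (x i).support) (fun i => (y i).support) R i X a.support b.support)
    {w : V →₀ ℤ} (hw : w ∈ Submodule.span ℤ (rowVec x y '' (R : Set ι))) :
    ∃ c : ℤ,
      w.filter (· ∈ X) - c • castInt a ∈ Submodule.span ℤ (rowVec x y ''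
        (rowsInside (fun i => (x i).support) (fun i => (y i).support) R X : Set ι)) ∧
      w.filter (· ∉ X) + c • castInt b ∈ Submodule.span ℤ (rowVec x y ''
        (rowsInside (fun i => (x i).support) (fun i => (y i).support) R Xᶜ : Set ι)) := by
  have inside : ∀ u : V →₀ ℤ, (∀ v ∈ u.support, v ∈ X) →
      u.filter (· ∈ X) = u ∧ u.filter (· ∉ X) = 0 := fun u hu =>
    ⟨Finsupp.filter_eq_self_iff _ _ |>.2 fun v hv => hu v (Finsupp.mem_support_iff.2 hv),
      Finsupp.filter_eq_zero_iff _ _ |>.2 fun v hv => by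
        by_contra h
        exact hv (hu v (Finsupp.mem_support_iff.2 h))⟩
  have outside : ∀ u : V →₀ ℤ, (∀ v ∈ u.support, v ∉ X) →
      u.filter (· ∈ X) = 0 ∧ u.filter (· ∉ X) = u := fun u hu =>
    ⟨Finsupp.filter_eq_zero_iff _ _ |>.2 fun v hv => by
        by_contra h
        exact hu v (Finsupp.mem_support_iff.2 h) hv,
      Finsupp.filter_eq_self_iff _ _ |>.2 fun v hv => hu v (Finsupp.mem_support_iff.2 hv)⟩
  have hsupp : ∀ j v, v ∈ (rowVec x y j).support → v ∈ (x j).support ∨ v ∈ (y j).support := by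
    intro j v hv
    have := Finsupp.support_sub hv
    rwa [support_castInt, support_castInt, Finset.mem_union] at this
  induction hw using Submodule.span_induction with
  | mem w hw =>
    obtain ⟨j, hj, rfl⟩ := hw
    by_cases hji : j = i
    · subst hji
      have ha := inside (castInt a) (by rw [support_castInt]; exact hc.subset)
      have hb := outside (castInt b) (by rw [support_castInt]; exact hc.subset_compl)
      rcases hab with ⟨rfl, rfl⟩ | ⟨rfl, rfl⟩
      · refine ⟨1, ?_, ?_⟩ <;> simp [rowVec, Finsupp.filter_sub, ha, hb]
      · refine ⟨-1, ?_, ?_⟩ <;> simp [rowVec, Finsupp.filter_sub, ha, hb]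
    · rcases hc.rows j hj hji with h | h
      · have := inside (rowVec x y j) fun v hv => (hsupp j v hv).elim (h.1 v) (h.2 v)
        refine ⟨0, ?_, ?_⟩
        · rw [this.1, zero_smul, sub_zero]
          exact Submodule.subset_span ⟨j, mem_rowsInside.2 ⟨hj, h⟩, rfl⟩
        · rw [this.2, zero_smul, add_zero]
          exact Submodule.zero_mem _
      · have := outside (rowVec x y j) fun v hv => (hsupp j v hv).elim (h.1 v) (h.2 v)
        refine ⟨0, ?_, ?_⟩
        · rw [this.1, zero_smul, sub_zero]
          exact Submodule.zero_mem _
        · rw [this.2, zero_smul, add_zero]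
          exact Submodule.subset_span ⟨j, mem_rowsInside.2 ⟨hj, h⟩, rfl⟩
  | zero => exact ⟨0, by simp [(inside 0 (by simp)).1], by simp [(inside 0 (by simp)).2]⟩
  | add u w _ _ hu hw =>
    obtain ⟨c, hc₁, hc₂⟩ := hu
    obtain ⟨c', hc₁', hc₂'⟩ := hw
    refine ⟨c + c', ?_, ?_⟩
    · rw [Finsupp.filter_add, add_smul, add_sub_add_comm]
      exact Submodule.add_mem _ hc₁ hc₁'
    · rw [Finsupp.filter_add, add_smul, add_add_add_comm]
      exact Submodule.add_mem _ hc₂ hc₂'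
  | smul k u _ hu =>
    obtain ⟨c, hc₁, hc₂⟩ := hu
    refine ⟨k * c, ?_, ?_⟩
    · rw [Finsupp.filter_smul, mul_smul, ← smul_sub]
      exact Submodule.smul_mem _ _ hc₁
    · rw [Finsupp.filter_smul, mul_smul, ← smul_add]
      exact Submodule.smul_mem _ _ hc₂

/-- A column set `C` together with relations `x i ~ y i`, `i ∈ R`, between the vectors `e v`,
`v ∈ C`, which generate the lattice of all relations and form a dominating family. -/
structure IsDominatingSystem [DecidableEq V] (e : V ↪ Fin m →₀ ℕ) (x y : ι → V →₀ ℕ)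
    (C : Finset V) (R : Finset ι) : Prop where
  ne_zero : ∀ v ∈ C, e v ≠ 0
  support_subset : ∀ i ∈ R, (x i).support ⊆ C ∧ (y i).support ⊆ C
  nonempty : ∀ i ∈ R, (x i).support.Nonempty ∧ (y i).support.Nonempty
  eval_eq : ∀ i ∈ R, Finsupp.linearCombination ℕ e (x i) = Finsupp.linearCombination ℕ e (y i)
  dominating : Dominating (fun i => (x i).support) (fun i => (y i).support) R
  span : ∀ u : V →₀ ℤ, (∀ v ∈ u.support, v ∈ C) → evalInt e u = 0 →
    u ∈ Submodule.span ℤ (rowVec x y '' (R : Set ι))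

theorem IsDominatingSystem.evalInt_eq_zero [DecidableEq V] {e : V ↪ Fin m →₀ ℕ}
    {x y : ι → V →₀ ℕ} {C : Finset V} {R : Finset ι} (h : IsDominatingSystem e x y C R)
    {R' : Finset ι} (hR' : R' ⊆ R) {u : V →₀ ℤ}
    (hu : u ∈ Submodule.span ℤ (rowVec x y '' (R' : Set ι))) : evalInt e u = 0 := by
  rw [← LinearMap.mem_ker]
  refine (Submodule.span_le.2 ?_) hu
  rintro _ ⟨i, hi, rfl⟩
  rw [SetLike.mem_coe, LinearMap.mem_ker, rowVec, map_sub, evalInt_castInt, evalInt_castInt,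
    h.eval_eq i (hR' hi), sub_self]

section

variable [DecidableEq V] {e : V ↪ Fin m →₀ ℕ} {x y : ι → V →₀ ℕ} {C : Finset V} {R : Finset ι}
  {i : ι} {X : Set V} {a b : V →₀ ℕ}

theorem IsDominatingSystem.side (h : IsDominatingSystem e x y C R)
    (hab : (a = x i ∧ b = y i) ∨ (a = y i ∧ b = x i)) (hi : i ∈ R) :
    a.support ⊆ C ∧ a.support.Nonempty ∧
      Finsupp.linearCombination ℕ e a = Finsupp.linearCombination ℕ e b ∧
      Finsupp.linearCombination ℕ e a ≠ 0 := by
  have h1 := h.support_subset i hi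
  have h2 := h.nonempty i hi
  have h3 := h.eval_eq i hi
  have ha : a.support ⊆ C ∧ a.support.Nonempty := by
    rcases hab with ⟨rfl, rfl⟩ | ⟨rfl, rfl⟩
    · exact ⟨h1.1, h2.1⟩
    · exact ⟨h1.2, h2.2⟩
  refine ⟨ha.1, ha.2, ?_, linearCombination_ne_zero (Finsupp.support_nonempty_iff.1 ha.2)
    fun v hv => h.ne_zero v (ha.1 hv)⟩
  rcases hab with ⟨rfl, rfl⟩ | ⟨rfl, rfl⟩
  · exact h3
  · exact h3.symm

theorem IsDominatingSystem.inside (h : IsDominatingSystem e x y C R)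
    (hab : (a = x i ∧ b = y i) ∨ (a = y i ∧ b = x i))
    (hc : IsCut (fun i => (x i).support) (fun i => (y i).support) R i X a.support b.support) :
    IsDominatingSystem e x y (part C X)
      (rowsInside (fun i => (x i).support) (fun i => (y i).support) R X) where
  ne_zero := fun v hv => h.ne_zero v (part_subset hv)
  support_subset := fun j hj => by
    have hj' := mem_rowsInside.1 hj
    have hs := h.support_subset j hj'.1
    exact ⟨fun v hv => mem_part.2 ⟨hs.1 hv, hj'.2.1 v hv⟩,
      fun v hv => mem_part.2 ⟨hs.2 hv, hj'.2.2 v hv⟩⟩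
  nonempty := fun j hj => h.nonempty j (rowsInside_subset hj)
  eval_eq := fun j hj => h.eval_eq j (rowsInside_subset hj)
  dominating := h.dominating.mono rowsInside_subset
  span := fun u hu hu0 => by
    classical
    obtain ⟨c, hc₁, hc₂⟩ := hc.exists_coeff hab
      (h.span u (fun v hv => part_subset (hu v hv)) hu0)
    have hf : u.filter (· ∈ X) = u := (Finsupp.filter_eq_self_iff _ _).2 fun v hv =>
      (mem_part.1 (hu v (Finsupp.mem_support_iff.2 hv))).2
    have hf' : u.filter (· ∉ X) = 0 := (Finsupp.filter_eq_zero_iff _ _).2 fun v hv => by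
      by_contra hv0
      exact hv (mem_part.1 (hu v (Finsupp.mem_support_iff.2 hv0))).2
    have hd := h.side hab hc.mem
    have hz := h.evalInt_eq_zero rowsInside_subset hc₂
    rw [hf', zero_add, map_smul, evalInt_castInt, ← hd.2.2.1, smul_eq_zero] at hz
    -- On the other side, `c` times the side `b` of the cut row is a relation.
    have hc0 : c = 0 := hz.resolve_right fun h0 =>
      hd.2.2.2 (toInt_injective (h0.trans toInt_zero.symm))
    rwa [hf, hc0, zero_smul, sub_zero] at hc₁

theorem IsDominatingSystem.isGluing (h : IsDominatingSystem e x y C R)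
    (hab : (a = x i ∧ b = y i) ∨ (a = y i ∧ b = x i))
    (hc : IsCut (fun i => (x i).support) (fun i => (y i).support) R i X a.support b.support) :
    IsGluing (C.map e) ((part C X).map e) ((part C Xᶜ).map e)
      (Finsupp.linearCombination ℕ e a) := by
  classical
  have ha := h.side hab hc.mem
  have hb := h.side (by tauto : (b = x i ∧ a = y i) ∨ (b = y i ∧ a = x i)) hc.mem
  have haC : ∀ v ∈ a.support, v ∈ part C X := fun v hv => mem_part.2 ⟨ha.1 hv, hc.subset v hv⟩
  have hbC : ∀ v ∈ b.support, v ∈ part C Xᶜ := fun v hv =>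
    mem_part.2 ⟨hb.1 hv, hc.subset_compl v hv⟩
  have hl : Finsupp.linearCombination ℕ e a ∈
      AddSubmonoid.closure (((part C X).map e : Finset _) : Set (Fin m →₀ ℕ)) := by
    rw [Finset.coe_map]
    exact linearCombination_mem_closure haC
  have hr : Finsupp.linearCombination ℕ e a ∈
      AddSubmonoid.closure (((part C Xᶜ).map e : Finset _) : Set (Fin m →₀ ℕ)) := by
    rw [Finset.coe_map, ha.2.2.1]
    exact linearCombination_mem_closure hbC
  refine ⟨?_, ?_, ?_, ?_, ha.2.2.2, hl, hr, ?_⟩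
  · obtain ⟨v, hv⟩ := ha.2.1
    exact ⟨e v, Finset.mem_map_of_mem e (haC v hv)⟩
  · obtain ⟨v, hv⟩ := hb.2.1
    exact ⟨e v, Finset.mem_map_of_mem e (hbC v hv)⟩
  · rw [Finset.disjoint_map, Finset.disjoint_left]
    exact fun v hv hv' => (mem_part.1 hv').2 (mem_part.1 hv).2
  · ext s
    simp only [Finset.mem_union, Finset.mem_map, mem_part]
    constructor
    · rintro (⟨v, hv, rfl⟩ | ⟨v, hv, rfl⟩) <;> exact ⟨v, hv.1, rfl⟩
    · rintro ⟨v, hv, rfl⟩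
      by_cases hvX : v ∈ X
      · exact Or.inl ⟨v, ⟨hv, hvX⟩, rfl⟩
      · exact Or.inr ⟨v, ⟨hv, hvX⟩, rfl⟩
  · ext z
    constructor
    · rintro ⟨hz₁, hz₂⟩
      rw [Finset.coe_map] at hz₁ hz₂
      obtain ⟨u₁, hu₁, rfl⟩ := exists_evalInt_of_mem_groupSpan hz₁
      obtain ⟨u₂, hu₂, heq⟩ := exists_evalInt_of_mem_groupSpan hz₂
      obtain ⟨c, hc₁, -⟩ := hc.exists_coeff hab (h.span (u₁ - u₂) (fun v hv =>
        (Finset.mem_union.1 (Finsupp.support_sub hv)).elim (fun hv => part_subset (hu₁ v hv))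
          (fun hv => part_subset (hu₂ v hv))) (by rw [map_sub, heq, sub_self]))
      have hf₁ : u₁.filter (· ∈ X) = u₁ := (Finsupp.filter_eq_self_iff _ _).2 fun v hv =>
        (mem_part.1 (hu₁ v (Finsupp.mem_support_iff.2 hv))).2
      have hf₂ : u₂.filter (· ∈ X) = 0 := (Finsupp.filter_eq_zero_iff _ _).2 fun v hv => by
        by_contra hv0
        exact (mem_part.1 (hu₂ v (Finsupp.mem_support_iff.2 hv0))).2 hv
      have hz := h.evalInt_eq_zero rowsInside_subset hc₁
      rw [Finsupp.filter_sub, hf₁, hf₂, sub_zero, map_sub, map_smul, evalInt_castInt,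
        sub_eq_zero] at hz
      exact ⟨c, hz⟩
    · rintro ⟨k, rfl⟩
      exact ⟨zsmul_toInt_mem_groupSpan hl k, zsmul_toInt_mem_groupSpan hr k⟩

/-- Without relations the vectors are linearly independent. -/
theorem IsDominatingSystem.linearIndependent (h : IsDominatingSystem e x y C (∅ : Finset ι)) :
    LinearIndependent ℚ fun a : C.map e => toRat (a : Fin m →₀ ℕ) := by
  classical
  rw [← LinearIndependent.iff_fractionRing (R := ℤ), Fintype.linearIndependent_iff]
  intro g hg
  set u : V →₀ ℤ := Finsupp.onFinset C
    (fun v => if hv : v ∈ C then g ⟨e v, Finset.mem_map_of_mem e hv⟩ else 0)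
    (fun v hv => by
      by_contra hvC
      exact hv (dif_neg hvC)) with hu
  have hval : ∀ v (hv : v ∈ C), u v = g ⟨e v, Finset.mem_map_of_mem e hv⟩ := fun v hv => by
    simp [hu, hv]
  have huC : u.support ⊆ C := Finsupp.support_onFinset_subset
  have hz : evalInt e u = 0 := by
    have hsum : evalInt e u = ∑ a : C.map e, g a • toInt (a : Fin m →₀ ℕ) := by
      rw [evalInt, Finsupp.linearCombination_apply, Finsupp.sum_of_support_subset u huC _ (by simp),
        ← Finset.sum_coe_sort C]
      refine Fintype.sum_bijective (fun v : C => (⟨e v, Finset.mem_map_of_mem e v.2⟩ : C.map e))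
        ⟨fun v w hvw => Subtype.ext (e.injective (congrArg Subtype.val hvw)), ?_⟩ _ _
        fun v => by rw [hval v v.2]
      rintro ⟨_, ha⟩
      obtain ⟨v, hv, rfl⟩ := Finset.mem_map.1 ha
      exact ⟨⟨v, hv⟩, rfl⟩
    rw [hsum]
    ext k
    have := congrFun hg k
    rw [Finset.sum_apply, Pi.zero_apply] at this ⊢
    have hcast : ∀ a : C.map e, (g a • toRat (a : Fin m →₀ ℕ)) k =
        (((g a • toInt (a : Fin m →₀ ℕ)) k : ℤ) : ℚ) := fun a => by
      rw [Pi.smul_apply, Pi.smul_apply, zsmul_eq_mul, smul_eq_mul, Int.cast_mul, toRat, toInt,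
        Int.cast_natCast]
    simp only [hcast] at this
    exact_mod_cast this
  have hu0 := h.span u (fun v hv => huC hv) hz
  simp only [Finset.coe_empty, Set.image_empty, Submodule.span_empty, Submodule.mem_bot] at hu0
  rintro ⟨_, ha⟩
  obtain ⟨v, hv, rfl⟩ := Finset.mem_map.1 ha
  rw [← hval v hv, hu0, Finsupp.zero_apply]

end

theorem IsDominatingSystem.exists_isIteratedGluing [DecidableEq V] {e : V ↪ Fin m →₀ ℕ}
    {x y : ι → V →₀ ℕ} {C : Finset V} {R : Finset ι} (h : IsDominatingSystem e x y C R) :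
    ∃ P D, IsIteratedGluing (C.map e) P D := by
  induction hn : R.card using Nat.strong_induction_on generalizing C R with
  | _ n ih =>
  rcases R.eq_empty_or_nonempty with rfl | hR
  · exact ⟨_, _, IsIteratedGluing.free _ h.linearIndependent⟩
  · obtain ⟨i, X, Q, Q', hc⟩ := h.dominating.exists_isCut h.nonempty hR
    obtain ⟨a, b, rfl, rfl, hab⟩ : ∃ a b : V →₀ ℕ, Q = a.support ∧ Q' = b.support ∧
        ((a = x i ∧ b = y i) ∨ (a = y i ∧ b = x i)) := by
      rcases hc.sides with ⟨rfl, rfl⟩ | ⟨rfl, rfl⟩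
      · exact ⟨x i, y i, rfl, rfl, Or.inl ⟨rfl, rfl⟩⟩
      · exact ⟨y i, x i, rfl, rfl, Or.inr ⟨rfl, rfl⟩⟩
    have hba : (b = x i ∧ a = y i) ∨ (b = y i ∧ a = x i) := by tauto
    obtain ⟨P₁, D₁, h₁⟩ := ih _ (hn ▸ hc.rowsInside_card_lt h.nonempty) (h.inside hab hc) rfl
    obtain ⟨P₂, D₂, h₂⟩ := ih _ (hn ▸ hc.symm.rowsInside_card_lt h.nonempty)
      (h.inside hba hc.symm) rfl
    exact ⟨_, _, IsIteratedGluing.glue _ _ _ _ _ _ _ _ (h.isGluing hab hc) h₁ h₂⟩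

end


/-! ### Minimal generating sets and presentations -/

section

variable {m : ℕ}

theorem IsMinimalGenerating.notMem_closure_erase {S : AddSubmonoid (Fin m →₀ ℕ)}
    {A : Finset (Fin m →₀ ℕ)} (hA : IsMinimalGenerating S A) {a : Fin m →₀ ℕ} (ha : a ∈ A) :
    a ∉ AddSubmonoid.closure ((A.erase a : Finset _) : Set (Fin m →₀ ℕ)) := by
  intro hmem
  have hgen : AddSubmonoid.closure ((A.erase a : Finset _) : Set (Fin m →₀ ℕ)) = S := by
    rw [← hA.prop]
    refine le_antisymm (AddSubmonoid.closure_mono (Finset.coe_subset.2 (Finset.erase_subset _ _)))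
      (AddSubmonoid.closure_le.2 fun b hb => ?_)
    by_cases hba : b = a
    · exact hba ▸ hmem
    · exact AddSubmonoid.subset_closure (Finset.mem_coe.2 (Finset.mem_erase.2 ⟨hba, hb⟩))
  exact Finset.notMem_erase a A (hA.le_of_le hgen (Finset.erase_subset _ _) ha)

theorem IsMinimalGenerating.ne_zero {S : AddSubmonoid (Fin m →₀ ℕ)} {A : Finset (Fin m →₀ ℕ)}
    (hA : IsMinimalGenerating S A) {a : Fin m →₀ ℕ} (ha : a ∈ A) : a ≠ 0 := by
  rintro rfl
  exact hA.notMem_closure_erase ha (zero_mem _)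

/-- The elements of a minimal generating set are irreducible, so every generating set contains
them. -/
theorem IsMinimalGenerating.subset {S : AddSubmonoid (Fin m →₀ ℕ)} {A B : Finset (Fin m →₀ ℕ)}
    (hA : IsMinimalGenerating S A)
    (hB : AddSubmonoid.closure (B : Set (Fin m →₀ ℕ)) = S) : A ⊆ B := by
  intro a ha
  by_contra haB
  set E := AddSubmonoid.closure ((A.erase a : Finset _) : Set (Fin m →₀ ℕ)) with hE
  have hAE : ∀ s ∈ AddSubmonoid.closure (A : Set (Fin m →₀ ℕ)), s ∈ E ∨ a ≤ s := by
    intro s hs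
    induction hs using AddSubmonoid.closure_induction with
    | mem s hs =>
      by_cases hsa : s = a
      · exact Or.inr hsa.ge
      · exact Or.inl (AddSubmonoid.subset_closure (Finset.mem_coe.2 (Finset.mem_erase.2 ⟨hsa, hs⟩)))
    | zero => exact Or.inl (zero_mem _)
    | add s t _ _ hs ht =>
      rcases hs with hs | hs
      · rcases ht with ht | ht
        · exact Or.inl (add_mem hs ht)
        · exact Or.inr (ht.trans le_add_self)
      · exact Or.inr (hs.trans le_self_add)
  have hBE : ∀ s ∈ AddSubmonoid.closure (B : Set (Fin m →₀ ℕ)), s ∈ E ∨ a < s := by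
    intro s hs
    induction hs using AddSubmonoid.closure_induction with
    | mem s hs =>
      refine (hAE s ?_).imp_right fun h => lt_of_le_of_ne h ?_
      · rw [hA.prop, ← hB]
        exact AddSubmonoid.subset_closure hs
      · rintro rfl
        exact haB hs
    | zero => exact Or.inl (zero_mem _)
    | add s t _ _ hs ht =>
      rcases hs with hs | hs
      · rcases ht with ht | ht
        · exact Or.inl (add_mem hs ht)
        · exact Or.inr (ht.trans_le le_add_self)
      · exact Or.inr (hs.trans_le le_self_add)
  have haS : a ∈ AddSubmonoid.closure (B : Set (Fin m →₀ ℕ)) := by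
    rw [hB, ← hA.prop]
    exact AddSubmonoid.subset_closure ha
  exact (hBE a haS).elim (hA.notMem_closure_erase ha) (lt_irrefl a)

theorem IsMinimalGenerating.unique {S : AddSubmonoid (Fin m →₀ ℕ)} {A B : Finset (Fin m →₀ ℕ)}
    (hA : IsMinimalGenerating S A) (hB : IsMinimalGenerating S B) : A = B :=
  (hA.subset hB.prop).antisymm (hB.subset hA.prop)

theorem factorizationHom_apply (A : Finset (Fin m →₀ ℕ)) (x : A →₀ ℕ) :
    factorizationHom A x =
      Finsupp.linearCombination ℕ (Function.Embedding.subtype (· ∈ A)) x := rfl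

theorem IsPresentation.eval_eq {A : Finset (Fin m →₀ ℕ)} {ρ : Set ((A →₀ ℕ) × (A →₀ ℕ))}
    (hρ : IsPresentation A ρ) {p : (A →₀ ℕ) × (A →₀ ℕ)} (hp : p ∈ ρ) :
    factorizationHom A p.1 = factorizationHom A p.2 := by
  have : addConGen (fun x y => (x, y) ∈ ρ) p.1 p.2 := AddConGen.Rel.of _ _ hp
  rw [hρ] at this
  exact this

theorem IsPresentation.rel {A : Finset (Fin m →₀ ℕ)} {ρ : Set ((A →₀ ℕ) × (A →₀ ℕ))}
    (hρ : IsPresentation A ρ) (c : AddCon (A →₀ ℕ)) (hc : ∀ p ∈ ρ, c p.1 p.2) {u v : A →₀ ℕ}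
    (huv : factorizationHom A u = factorizationHom A v) : c u v := by
  have h : addConGen (fun x y => (x, y) ∈ ρ) ≤ c :=
    AddCon.addConGen_le.2 fun x y hxy => hc (x, y) hxy
  rw [hρ] at h
  exact h huv

theorem IsMinimalPresentation.fst_ne_snd {A : Finset (Fin m →₀ ℕ)}
    {ρ : Set ((A →₀ ℕ) × (A →₀ ℕ))} (hρ : IsMinimalPresentation A ρ)
    {p : (A →₀ ℕ) × (A →₀ ℕ)} (hp : p ∈ ρ) : p.1 ≠ p.2 := by
  intro heq
  have hgen : IsPresentation A (ρ \ {p}) := by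
    rw [IsPresentation, ← hρ.prop]
    refine le_antisymm (AddCon.addConGen_mono fun x y h => h.1)
      (AddCon.addConGen_le.2 fun x y h => ?_)
    by_cases hxy : (x, y) = p
    · subst hxy
      simp only at heq
      exact heq ▸ AddCon.refl _ _
    · exact AddConGen.Rel.of _ _ ⟨h, hxy⟩
  exact (hρ.le_of_le hgen Set.sdiff_subset hp).2 rfl

/-- The congruence on exponent vectors given by the binomials in an ideal. -/
noncomputable def binomialCon {σ : Type*} (I : Ideal (MvPolynomial σ ℚ)) : AddCon (σ →₀ ℕ) where
  r u v := MvPolynomial.monomial u (1 : ℚ) - MvPolynomial.monomial v 1 ∈ I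
  iseqv :=
    { refl := fun u => by simp
      symm := fun {u v} h => by simpa using I.neg_mem h
      trans := fun {u v w} h h' => by simpa using I.add_mem h h' }
  add' := fun {u v w z} h h' => by
    have hsplit : MvPolynomial.monomial (u + w) (1 : ℚ) - MvPolynomial.monomial (v + z) 1 =
        MvPolynomial.monomial w 1 * (MvPolynomial.monomial u 1 - MvPolynomial.monomial v 1) +
        MvPolynomial.monomial v 1 * (MvPolynomial.monomial w 1 - MvPolynomial.monomial z 1) := by
      simp only [mul_sub, MvPolynomial.monomial_mul, mul_one]
      rw [add_comm w u, add_comm w v]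
      abel
    rw [hsplit]
    exact I.add_mem (I.mul_mem_left _ h) (I.mul_mem_left _ h')

/-- The space of rational relations between the vectors of `A`. -/
noncomputable def relationSpace (A : Finset (Fin m →₀ ℕ)) : Submodule ℚ (A → ℚ) :=
  LinearMap.ker (Fintype.linearCombination ℚ fun a : A => toRat (a : Fin m →₀ ℕ))

theorem toRat_linearCombination (A : Finset (Fin m →₀ ℕ)) (x : A →₀ ℕ) :
    toRat (factorizationHom A x) =
      Fintype.linearCombination ℚ (fun a : A => toRat (a : Fin m →₀ ℕ)) fun a => (x a : ℚ) := by
  ext k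
  rw [factorizationHom_apply, Finsupp.linearCombination_apply,
    Finsupp.sum_fintype _ _ (by simp), Fintype.linearCombination_apply]
  simp [toRat, Finsupp.finsetSum_apply]

theorem mem_relationSpace_iff {A : Finset (Fin m →₀ ℕ)} {x y : A →₀ ℕ} :
    (fun a => (x a : ℚ) - y a) ∈ relationSpace A ↔
      factorizationHom A x = factorizationHom A y := by
  have : (fun a => (x a : ℚ) - y a) = (fun a => (x a : ℚ)) - fun a => (y a : ℚ) := rfl
  rw [relationSpace, LinearMap.mem_ker, this, map_sub, ← toRat_linearCombination,
    ← toRat_linearCombination, sub_eq_zero]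
  refine ⟨fun h => ?_, fun h => by rw [h]⟩
  ext k
  exact Nat.cast_injective (congrFun h k)

theorem finrank_relationSpace_add_dimension {S : AddSubmonoid (Fin m →₀ ℕ)}
    {A : Finset (Fin m →₀ ℕ)} (hA : AddSubmonoid.closure (A : Set (Fin m →₀ ℕ)) = S) :
    Module.finrank ℚ (relationSpace A) + dimension S = A.card := by
  have hrange : LinearMap.range (Fintype.linearCombination ℚ fun a : A =>
      toRat (a : Fin m →₀ ℕ)) = Submodule.span ℚ (toRat '' (S : Set (Fin m →₀ ℕ))) := by
    refine le_antisymm ?_ (Submodule.span_le.2 ?_)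
    · rw [Fintype.range_linearCombination]
      refine Submodule.span_mono ?_
      rintro _ ⟨a, rfl⟩
      exact ⟨a, hA ▸ AddSubmonoid.subset_closure a.2, rfl⟩
    · rintro _ ⟨s, hs, rfl⟩
      have hs' : s ∈ AddSubmonoid.closure
          ((Function.Embedding.subtype (· ∈ A)) '' (Set.univ : Set A)) := by
        simpa [hA] using hs
      obtain ⟨x, -, rfl⟩ := exists_linearCombination_of_mem_closure hs'
      rw [← factorizationHom_apply, toRat_linearCombination]
      exact LinearMap.mem_range_self _ _
  have := LinearMap.finrank_range_add_finrank_ker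
    (Fintype.linearCombination ℚ fun a : A => toRat (a : Fin m →₀ ℕ))
  rw [hrange, Module.finrank_fintype_fun_eq_card, Fintype.card_coe] at this
  rw [dimension, relationSpace, add_comm]
  exact this

theorem IsPresentation.toricIdeal_eq_span {A : Finset (Fin m →₀ ℕ)}
    {ρ : Set ((A →₀ ℕ) × (A →₀ ℕ))} (hρ : IsPresentation A ρ) :
    toricIdeal (relationSpace A) = Ideal.span (Set.range fun p : ρ =>
      MvPolynomial.monomial p.1.1 (1 : ℚ) - MvPolynomial.monomial p.1.2 1) := by
  refine le_antisymm (ker_mapDomainRingHom_le _ fun x y hxy => ?_) (Ideal.span_le.2 ?_)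
  · rw [expHom_eq_iff, mem_relationSpace_iff] at hxy
    exact hρ.rel (binomialCon _) (fun p hp =>
      Ideal.subset_span (Set.mem_range_self (⟨p, hp⟩ : ρ))) hxy
  · rintro _ ⟨p, rfl⟩
    exact binomial_mem_toricIdeal_iff.2 (mem_relationSpace_iff.2 (hρ.eval_eq p.2))

/-- A presentation generates the lattice of integer relations. -/
theorem IsPresentation.mem_span_rowVec {A : Finset (Fin m →₀ ℕ)}
    {ρ : Set ((A →₀ ℕ) × (A →₀ ℕ))} (hρ : IsPresentation A ρ) {u : A →₀ ℤ}
    (hu : evalInt (Function.Embedding.subtype (· ∈ A)) u = 0) :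
    u ∈ Submodule.span ℤ (Set.range (rowVec (fun p : ρ => p.1.1) fun p : ρ => p.1.2)) := by
  set L := Submodule.span ℤ (Set.range (rowVec (fun p : ρ => p.1.1) fun p : ρ => p.1.2)) with hL
  have huv : castInt (u.mapRange Int.toNat rfl) - castInt ((-u).mapRange Int.toNat rfl) = u := by
    ext a
    rw [Finsupp.sub_apply, castInt_apply, castInt_apply, Finsupp.mapRange_apply,
      Finsupp.mapRange_apply, Finsupp.neg_apply, Int.toNat_sub_toNat_neg]
  have heq : factorizationHom A (u.mapRange Int.toNat rfl) =
      factorizationHom A ((-u).mapRange Int.toNat rfl) := by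
    rw [← huv, map_sub, evalInt_castInt, evalInt_castInt, sub_eq_zero] at hu
    exact toInt_injective hu
  have := hρ.rel (AddCon.ker (L.mkQ.toAddMonoidHom.comp castInt)) (fun p hp =>
    (Submodule.Quotient.eq L).2 (Submodule.subset_span (Set.mem_range_self (⟨p, hp⟩ : ρ)))) heq
  rw [← huv]
  exact (Submodule.Quotient.eq L).1 this

/-- The relations of a minimal presentation of a complete intersection form a dominating system. -/
theorem IsMinimalGenerating.isDominatingSystem {S : AddSubmonoid (Fin m →₀ ℕ)}
    {A : Finset (Fin m →₀ ℕ)} (hA : IsMinimalGenerating S A)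
    {ρ : Set ((A →₀ ℕ) × (A →₀ ℕ))} [Fintype ρ] (hρ : IsMinimalPresentation A ρ)
    (hcard : Fintype.card ρ + dimension S = A.card) :
    IsDominatingSystem (Function.Embedding.subtype (· ∈ A)) (fun p : ρ => p.1.1)
      (fun p : ρ => p.1.2) Finset.univ Finset.univ := by
  have hne : ∀ p : ρ, p.1.1 ≠ 0 ∧ p.1.2 ≠ 0 := by
    intro p
    have hp := hρ.prop.eval_eq p.2
    have hpne := hρ.fst_ne_snd p.2
    rw [factorizationHom_apply, factorizationHom_apply] at hp
    constructor
    · intro h0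
      rw [h0, map_zero] at hp
      exact linearCombination_ne_zero (fun h => hpne (h0.trans h.symm))
        (fun v _ => hA.ne_zero v.2) hp.symm
    · intro h0
      rw [h0, map_zero] at hp
      exact linearCombination_ne_zero (fun h => hpne (h.trans h0.symm))
        (fun v _ => hA.ne_zero v.2) hp
  have hdim := finrank_relationSpace_add_dimension hA.prop
  exact
    { ne_zero := fun v _ => hA.ne_zero v.2
      support_subset := fun _ _ => ⟨Finset.subset_univ _, Finset.subset_univ _⟩
      nonempty := fun p _ => ⟨Finsupp.support_nonempty_iff.2 (hne p).1,
        Finsupp.support_nonempty_iff.2 (hne p).2⟩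
      eval_eq := fun p _ => hρ.prop.eval_eq p.2
      dominating := dominating_of_span_binomials (relationSpace A) _ _ (fun p => (hne p).1)
        (fun p => (hne p).2) hρ.prop.toricIdeal_eq_span (by omega)
      span := fun u _ hu => by
        rw [Finset.coe_univ, Set.image_univ]
        exact hρ.prop.mem_span_rowVec hu }

theorem IsCompleteIntersection.exists_isIteratedGluing {S : AddSubmonoid (Fin m →₀ ℕ)}
    {A : Finset (Fin m →₀ ℕ)} (hA : IsMinimalGenerating S A) (hS : IsCompleteIntersection S) :
    ∃ P D, IsIteratedGluing A P D := by
  obtain ⟨A', hA', ρ, hρ, hcard⟩ := hS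
  obtain rfl := hA.unique hA'
  have hfin : ρ.Finite := by
    rw [← Set.encard_ne_top_iff]
    intro h
    rw [h, top_add] at hcard
    exact ENat.natCast_ne_top _ hcard.symm
  have := hfin.fintype
  rw [← Set.coe_fintypeCard] at hcard
  have h := (hA.isDominatingSystem hρ (by exact_mod_cast hcard)).exists_isIteratedGluing
  rwa [← Finset.attach_eq_univ, Finset.attach_map_val] at h

end


/-! ### Hilbert series -/

section

variable {m : ℕ}

open Classical in
/-- The generating series of a set of exponent vectors. -/
noncomputable def setSeries (T : Set (Fin m →₀ ℕ)) : MvPowerSeries (Fin m) ℚ :=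
  fun s => if s ∈ T then 1 else 0

open Classical in
theorem coeff_setSeries (T : Set (Fin m →₀ ℕ)) (s : Fin m →₀ ℕ) :
    MvPowerSeries.coeff s (setSeries T) = if s ∈ T then 1 else 0 := rfl

theorem hilbertSeries_eq_setSeries (S : AddSubmonoid (Fin m →₀ ℕ)) :
    hilbertSeries S = setSeries (S : Set (Fin m →₀ ℕ)) := rfl

/-- If every element of `T` is in a unique way a sum of elements of `T₁` and `T₂`, then the
series multiply. -/
theorem setSeries_mul {T₁ T₂ T : Set (Fin m →₀ ℕ)} (hadd : ∀ a ∈ T₁, ∀ b ∈ T₂, a + b ∈ T)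
    (hex : ∀ t ∈ T, ∃ a ∈ T₁, ∃ b ∈ T₂, a + b = t)
    (huniq : ∀ a ∈ T₁, ∀ b ∈ T₂, ∀ a' ∈ T₁, ∀ b' ∈ T₂, a + b = a' + b' → b = b') :
    setSeries T₁ * setSeries T₂ = setSeries T := by
  classical
  ext t
  rw [MvPowerSeries.coeff_mul, coeff_setSeries]
  simp only [coeff_setSeries]
  by_cases ht : t ∈ T
  · obtain ⟨a, ha, b, hb, rfl⟩ := hex t ht
    rw [if_pos ht, Finset.sum_eq_single (a, b), if_pos ha, if_pos hb, one_mul]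
    · rintro ⟨a', b'⟩ hp hne
      rw [Finset.HasAntidiagonal.mem_antidiagonal] at hp
      by_cases ha' : a' ∈ T₁
      · by_cases hb' : b' ∈ T₂
        · have hbb := huniq a' ha' b' hb' a ha b hb hp
          subst hbb
          exact (hne (Prod.ext (add_right_cancel (b := b') hp) rfl)).elim
        · simp [hb']
      · simp [ha']
    · intro h
      rw [Finset.HasAntidiagonal.mem_antidiagonal] at h
      exact absurd rfl h
  · rw [if_neg ht]
    refine Finset.sum_eq_zero ?_
    rintro ⟨a, b⟩ hp
    rw [Finset.HasAntidiagonal.mem_antidiagonal] at hp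
    by_cases ha : a ∈ T₁
    · by_cases hb : b ∈ T₂
      · exact absurd (hp ▸ hadd a ha b hb) ht
      · simp [hb]
    · simp [ha]

/-- The Apéry set of `S` with respect to `d`: the elements of `S` that stop being in `S` when `d`
is subtracted. -/
def aperySet (S : AddSubmonoid (Fin m →₀ ℕ)) (d : Fin m →₀ ℕ) : Set (Fin m →₀ ℕ) :=
  {s | s ∈ S ∧ ∀ t ∈ S, s ≠ t + d}

theorem oneSubPow_mul_hilbertSeries {S : AddSubmonoid (Fin m →₀ ℕ)} {d : Fin m →₀ ℕ}
    (hd : d ∈ S) : oneSubPow d * hilbertSeries S = setSeries (aperySet S d) := by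
  classical
  ext s
  rw [oneSubPow, sub_mul, one_mul, map_sub, MvPowerSeries.coeff_monomial_mul, one_mul,
    hilbertSeries_eq_setSeries, coeff_setSeries, coeff_setSeries, coeff_setSeries]
  by_cases h : ∃ t ∈ S, s = t + d
  · obtain ⟨t, ht, rfl⟩ := h
    have h1 : t + d ∈ (S : Set (Fin m →₀ ℕ)) := S.add_mem ht hd
    have h2 : t + d ∉ aperySet S d := fun h => h.2 t ht rfl
    have h3 : d ≤ t + d := le_add_self
    rw [if_pos h1, if_neg h2, if_pos h3, add_tsub_cancel_right, if_pos (SetLike.mem_coe.2 ht),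
      sub_self]
  · push Not at h
    have h1 : s ∈ aperySet S d ↔ s ∈ (S : Set (Fin m →₀ ℕ)) := ⟨fun h => h.1, fun hs => ⟨hs, h⟩⟩
    have h2 : (if d ≤ s then if s - d ∈ (S : Set (Fin m →₀ ℕ)) then (1 : ℚ) else 0 else 0) = 0 := by
      split_ifs with hds hS
      · exact absurd (tsub_add_cancel_of_le hds).symm (h _ hS)
      · rfl
      · rfl
    rw [h2, sub_zero]
    simp only [h1]

theorem eq_of_mem_aperySet {S : AddSubmonoid (Fin m →₀ ℕ)} {d w w' : Fin m →₀ ℕ} (hd : d ∈ S)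
    (hw : w ∈ aperySet S d) (hw' : w' ∈ aperySet S d) {k : ℤ}
    (h : toInt w' - toInt w = k • toInt d) : w = w' := by
  have key : ∀ {w w' : Fin m →₀ ℕ} {n : ℕ}, w ∈ S → w' ∈ aperySet S d →
      toInt w' - toInt w = (n : ℤ) • toInt d → w = w' := by
    intro w w' n hw hw' h
    rw [← toInt_nsmul, sub_eq_iff_eq_add, ← toInt_add] at h
    have h := toInt_injective h
    cases n with
    | zero => simpa using h.symm
    | succ n =>
      refine absurd ?_ (hw'.2 (n • d + w) (S.add_mem (S.nsmul_mem hd n) hw))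
      rw [h, succ_nsmul]
      abel
  obtain ⟨n, rfl | rfl⟩ := k.eq_nat_or_neg
  · exact key hw.1 hw' h
  · refine (key (n := n) hw'.1 hw ?_).symm
    rw [← neg_sub, h, neg_smul, neg_neg]

/-- In a gluing, every element is in a unique way the sum of an element of `⟨A₁⟩` and of an
element of the Apéry set of `⟨A₂⟩` with respect to `d`. -/
theorem IsGluing.hilbertSeries_eq {A A₁ A₂ : Finset (Fin m →₀ ℕ)} {d : Fin m →₀ ℕ}
    (h : IsGluing A A₁ A₂ d) :
    hilbertSeries (AddSubmonoid.closure (A : Set (Fin m →₀ ℕ))) =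
      hilbertSeries (AddSubmonoid.closure (A₁ : Set (Fin m →₀ ℕ))) *
        (oneSubPow d * hilbertSeries (AddSubmonoid.closure (A₂ : Set (Fin m →₀ ℕ)))) := by
  classical
  have hsup : AddSubmonoid.closure (A : Set (Fin m →₀ ℕ)) =
      AddSubmonoid.closure (A₁ : Set (Fin m →₀ ℕ)) ⊔
        AddSubmonoid.closure (A₂ : Set (Fin m →₀ ℕ)) := by
    rw [← h.union, Finset.coe_union, AddSubmonoid.closure_union]
  rw [oneSubPow_mul_hilbertSeries h.mem_right, hilbertSeries_eq_setSeries,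
    hilbertSeries_eq_setSeries, hsup]
  refine (setSeries_mul ?_ ?_ ?_).symm
  · exact fun a ha b hb => AddSubmonoid.add_mem_sup ha hb.1
  · intro t ht
    obtain ⟨a, ha, b, hb, rfl⟩ := AddSubmonoid.mem_sup.1 ht
    clear ht
    induction b using WellFoundedLT.induction generalizing a with
    | ind b ih =>
      by_cases hbA : b ∈ aperySet (AddSubmonoid.closure (A₂ : Set (Fin m →₀ ℕ))) d
      · exact ⟨a, ha, b, hbA, rfl⟩
      · have : ∃ t ∈ AddSubmonoid.closure (A₂ : Set (Fin m →₀ ℕ)), b = t + d := by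
          by_contra! hcon
          exact hbA ⟨hb, hcon⟩
        obtain ⟨t, ht, rfl⟩ := this
        obtain ⟨a', ha', b', hb', heq⟩ := ih t
          (lt_add_of_pos_right t (pos_iff_ne_zero.2 h.ne_zero)) (a + d)
          (AddSubmonoid.add_mem _ ha h.mem_left) ht
        exact ⟨a', ha', b', hb', by rw [heq, add_assoc, add_comm d t]⟩
  · intro a ha b hb a' ha' b' hb' heq
    have hz : toInt a - toInt a' = toInt b' - toInt b := by
      have := congrArg toInt heq
      rw [toInt_add, toInt_add] at this
      rw [sub_eq_sub_iff_add_eq_add, this, add_comm]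
    have hmem : toInt b' - toInt b ∈ {z | ∃ k : ℤ, z = k • toInt d} := by
      rw [← h.inter]
      exact ⟨⟨a, ha, a', ha', hz.symm⟩, ⟨b', hb'.1, b, hb.1, rfl⟩⟩
    obtain ⟨k, hk⟩ := hmem
    exact eq_of_mem_aperySet h.mem_right hb hb' hk

theorem toRat_mem_span {A : Set (Fin m →₀ ℕ)} {s : Fin m →₀ ℕ}
    (hs : s ∈ AddSubmonoid.closure A) : toRat s ∈ Submodule.span ℚ (toRat '' A) := by
  induction hs using AddSubmonoid.closure_induction with
  | mem s hs => exact Submodule.subset_span ⟨s, hs, rfl⟩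
  | zero =>
    have : toRat (0 : Fin m →₀ ℕ) = 0 := by
      ext i
      simp [toRat]
    rw [this]
    exact Submodule.zero_mem _
  | add s t _ _ hs ht =>
    have : toRat (s + t) = toRat s + toRat t := by
      ext i
      simp [toRat]
    rw [this]
    exact Submodule.add_mem _ hs ht

/-- Adding a generator `a` that is linearly independent of `A`, the Apéry set with respect to `a`
is the old monoid. -/
theorem aperySet_closure_insert {A : Set (Fin m →₀ ℕ)} {a : Fin m →₀ ℕ}
    (ha : toRat a ∉ Submodule.span ℚ (toRat '' A)) :
    aperySet (AddSubmonoid.closure (insert a A)) a =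
      (AddSubmonoid.closure A : Set (Fin m →₀ ℕ)) := by
  have hdecomp : ∀ s ∈ AddSubmonoid.closure (insert a A),
      ∃ n : ℕ, ∃ t ∈ AddSubmonoid.closure A, n • a + t = s := by
    intro s hs
    rw [Set.insert_eq, AddSubmonoid.closure_union, AddSubmonoid.mem_sup] at hs
    obtain ⟨b, hb, t, ht, rfl⟩ := hs
    obtain ⟨n, rfl⟩ := AddSubmonoid.mem_closure_singleton.1 hb
    exact ⟨n, t, ht, rfl⟩
  have hle : AddSubmonoid.closure A ≤ AddSubmonoid.closure (insert a A) :=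
    AddSubmonoid.closure_mono (Set.subset_insert a A)
  ext s
  constructor
  · rintro ⟨hs, hsa⟩
    obtain ⟨n, t, ht, rfl⟩ := hdecomp s hs
    cases n with
    | zero => simpa using ht
    | succ n =>
      refine absurd ?_ (hsa (n • a + t) (AddSubmonoid.add_mem _ (AddSubmonoid.nsmul_mem _
        (AddSubmonoid.subset_closure (Set.mem_insert a A)) n) (hle ht)))
      rw [succ_nsmul]
      abel
  · refine fun hs => ⟨hle hs, fun t ht heq => ha ?_⟩
    obtain ⟨n, t, ht', rfl⟩ := hdecomp t ht
    have hr : ((n : ℚ) + 1) • toRat a = toRat s - toRat t := by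
      rw [heq]
      ext i
      simp [toRat]
      ring
    have hmem := Submodule.sub_mem _ (toRat_mem_span hs) (toRat_mem_span ht')
    rw [← hr] at hmem
    exact (Submodule.smul_mem_iff _ (by positivity)).1 hmem

theorem hilbertSeries_mul_prod_of_linearIndependent {A : Finset (Fin m →₀ ℕ)}
    (hA : LinearIndependent ℚ fun a : A => toRat (a : Fin m →₀ ℕ)) :
    hilbertSeries (AddSubmonoid.closure (A : Set (Fin m →₀ ℕ))) * ∏ a ∈ A, oneSubPow a = 1 := by
  classical
  have hA : LinearIndepOn ℚ toRat (A : Set (Fin m →₀ ℕ)) := hA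
  induction A using Finset.induction_on with
  | empty =>
    ext s
    rw [Finset.prod_empty, mul_one, Finset.coe_empty, AddSubmonoid.closure_empty,
      hilbertSeries_eq_setSeries, coeff_setSeries, MvPowerSeries.coeff_one]
    simp
  | insert a A ha ih =>
    rw [Finset.coe_insert, linearIndepOn_insert (by exact_mod_cast ha)] at hA
    have hmem : a ∈ AddSubmonoid.closure (insert a (A : Set (Fin m →₀ ℕ))) :=
      AddSubmonoid.subset_closure (Set.mem_insert a _)
    rw [Finset.prod_insert ha, Finset.coe_insert, ← mul_assoc, mul_comm _ (oneSubPow a),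
      oneSubPow_mul_hilbertSeries hmem, aperySet_closure_insert hA.2,
      ← hilbertSeries_eq_setSeries]
    exact ih hA.1 hA.1

theorem IsIteratedGluing.hilbertSeries_mul_prod {A : Finset (Fin m →₀ ℕ)}
    {P : List (Finset (Fin m →₀ ℕ))} {D : List (Fin m →₀ ℕ)} (h : IsIteratedGluing A P D) :
    hilbertSeries (AddSubmonoid.closure (A : Set (Fin m →₀ ℕ))) * ∏ a ∈ A, oneSubPow a =
      (D.map fun d => oneSubPow d).prod := by
  classical
  induction h with
  | free A hA =>
    rw [List.map_nil, List.prod_nil]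
    exact hilbertSeries_mul_prod_of_linearIndependent hA
  | glue A A₁ A₂ d P₁ P₂ D₁ D₂ h _ _ ih₁ ih₂ =>
    rw [h.hilbertSeries_eq, List.map_append, List.map_cons, List.prod_append, List.prod_cons,
      ← ih₁, ← ih₂, ← h.union, Finset.prod_union h.disjoint]
    ring

theorem constantCoeff_prod_oneSubPow_ne_zero {A : Finset (Fin m →₀ ℕ)} (hA : ∀ a ∈ A, a ≠ 0) :
    MvPowerSeries.constantCoeff (∏ a ∈ A, oneSubPow a) ≠ 0 := by
  classical
  rw [map_prod, Finset.prod_ne_zero_iff]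
  intro a ha
  rw [oneSubPow, map_sub, map_one, ← MvPowerSeries.coeff_zero_eq_constantCoeff_apply,
    MvPowerSeries.coeff_monomial, if_neg (hA a ha).symm, sub_zero]
  exact one_ne_zero

end

end AffineSemigroup

theorem mainTheorem3 {m : ℕ} (S : AddSubmonoid (Fin m →₀ ℕ)) (A : Finset (Fin m →₀ ℕ))
    (hA : AffineSemigroup.IsMinimalGenerating S A)
    (hS : AffineSemigroup.IsCompleteIntersection S) :
    (∃ (P : List (Finset (Fin m →₀ ℕ))) (D : List (Fin m →₀ ℕ)),
      AffineSemigroup.IsIteratedGluing A P D) ∧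
    ∀ (P : List (Finset (Fin m →₀ ℕ))) (D : List (Fin m →₀ ℕ)),
      AffineSemigroup.IsIteratedGluing A P D →
        AffineSemigroup.hilbertSeries S =
          (D.map fun d => AffineSemigroup.oneSubPow d).prod *
            (∏ a ∈ A, AffineSemigroup.oneSubPow a)⁻¹ := by
  refine ⟨AffineSemigroup.IsCompleteIntersection.exists_isIteratedGluing hA hS, fun P D h => ?_⟩
  rw [MvPowerSeries.eq_mul_inv_iff_mul_eq
    (AffineSemigroup.constantCoeff_prod_oneSubPow_ne_zero fun a ha => hA.ne_zero ha),
    ← h.hilbertSeries_mul_prod, hA.prop]
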